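/- **Setting.** Let $\mathcal Z$ be a compact metric space and $\mu$ a Borel probability measure on $\mathcal Z$ with support $\mathcal Z$. Let $n,p\ge 1$ and let $\mathbf x_i=\boldsymbol\psi(z_i)+\sigma_x\mathbf e_i\in\mathbb R^p$, $i=1,\dots,n$, follow the Latent Metric Model: $z_1,\dots,z_n$ are i.i.d. with law $\mu$; $\boldsymbol\psi=(\psi_1,\dots,\psi_p)$, where $\psi_1,\dots,\psi_p$ are mutually independent, jointly measurable, mean-square continuous real random functions on $\mathcal Z$ with $\sup_{j,z}\mathbb E|\psi_j(z)|^4<\infty$; $\mathbf e_1,\dots,\mathbf e_n$ are i.i.d. random vectors in $\mathbb R^p$ with independent, zero-mean, unit-variance entries having finite fourth moments; and $\sigma_x\ge 0$. Let $\epsilon_1,\dots,\epsilon_n$ be i.i.d. with mean zero and variance $\sigma_y^2<\infty$. The families $\boldsymbol\psi$, $(z_i)$, $(\mathbf e_i)$, $(\epsilon_i)$ are independent. Let $\gamma\ge 0$. Suppose that the integral operator on $L_2(\mu)$ of the implicit kernel $f(z,z')=\frac1p\mathbb E\langle\boldsymbol\psi(z),\boldsymbol\psi(z')\rangle$ has exactly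 $k_{\max}$ nonzero eigenvalues $\lambda_1\ge\dots\ge\lambda_{k_{\max}}>0$ (with multiplicity), $1\le k_{\max}<\infty$, with corresponding $L_2(\mu)$-orthonormal continuous eigenfunctions $u_1,\dots,u_{k_{\max}}$. Put $\boldsymbol\Lambda=\mathrm{diag}(\lambda_1,\dots,\lambda_{k_{\max}})$, $\phi(z)=(\lambda_k^{1/2}u_k(z))_{k\le k_{\max}}$, let $\boldsymbol\Phi\in\mathbb R^{n\times k_{\max}}$ have rows $\phi(z_i)^\top$, and let $\mathbf W\in\mathbb R^{p\times k_{\max}}$, $\mathbf W_{jk}=(\lambda_kp)^{-1/2}\int\psi_ju_k\,d\mu$. Let the regression function be $g=\langle\phi(\cdot),\theta^*\rangle$ with $\theta^*\in\mathbb R^{k_{\max}}$. Let $\mathbf X$ and $\mathbf E$ be the $n\times p$ matrices with rows $\mathbf x_i^\top$ and $\mathbf e_i^\top$, and set $$\mathbf A=p^{-1}\mathbf X\mathbf X^\top+n\gamma\mathbf I_n,\qquad \hat\theta(\tilde{\mathbf y})=\boldsymbol\Phi^\top\mathbf A^{-1}\tilde{\mathbf y},$$ $$\boldsymbol\Delta=\boldsymbol\Phi(\mathbf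 W^\top\mathbf W-\mathbf I)\boldsymbol\Phi^\top+p^{-1/2}\sigma_x(\boldsymbol\Phi\mathbf W^\top\mathbf E^\top+\mathbf E\mathbf W\boldsymbol\Phi^\top)+p^{-1}\sigma_x^2(\mathbf E\mathbf E^\top-p\mathbf I_n),$$ $$B=\|\hat\theta(\boldsymbol\Phi\theta^*)-\theta^*\|_{\boldsymbol\Lambda}^2,\qquad V=\mathbb E_{\boldsymbol\epsilon}\big[\|\hat\theta(\boldsymbol\epsilon)\|_{\boldsymbol\Lambda}^2\big],$$ $$\beta_{k_{\max}}=\sup_{z\in\mathcal Z}\frac1{k_{\max}}\sum_{k\le k_{\max}}u_k(z)^2,\qquad C^{(k_{\max})}_{p,n}=\{2\|\boldsymbol\Delta\|_2\ge\sigma_x^2+n\gamma\},$$ where $\|v\|_{\mathbf D}^2=v^\top\mathbf Dv$, $\|\cdot\|_2$ is the spectral norm, and $\mathbb E_{\boldsymbol\epsilon}$ averages over $\boldsymbol\epsilon=(\epsilon_1,\dots,\epsilon_n)$ only. **Theorem.** There exist absolute constants $c,c',c_1,c_2>0$ such that, in every such setting with $\max(\sigma_x,\gamma)>0$ and $n\ge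 c\,\beta_{k_{\max}}k_{\max}\log k_{\max}$, with probability at least $$1-16\exp\Big(-\frac{c'n}{\beta_{k_{\max}}^2k_{\max}}\Big)-2\,\mathbb P\big(C^{(k_{\max})}_{p,n}\big)$$ the matrix $\mathbf A$ is invertible and the following two bounds hold simultaneously: $$V\le c_1\sigma_y^2\,\frac{k_{\max}}n,\qquad B\le c_2\,\frac{\|\theta^*\|_{\boldsymbol\Lambda^{-1}}^2}{n^2}\,(\sigma_x^2+n\gamma)^2 .$$ -/

import Mathlib

open MeasureTheory ProbabilityTheory Filter Topology

/-- The data of a Latent Metric Model with `n` observations in dimension `p`, together with the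
response noise and the ridge parameter: latent positions `z i`, random functions `psi j`,
covariate noise `E i j` (row `i` is the vector `e_i`), response noise `eps i`. -/
structure LMM (Z Ω : Type*) [MeasurableSpace Z] [MeasurableSpace Ω] (p n : ℕ) where
  /-- the underlying probability measure -/
  P : Measure Ω
  /-- the distribution of the latent positions -/
  mu : Measure Z
  /-- the random functions -/
  psi : Fin p → Z → Ω → ℝ
  /-- the latent positions -/
  z : Fin n → Ω → Z
  /-- the matrix of covariate noise -/
  E : Fin n → Fin p → Ω → ℝ
  /-- the response noise -/
  eps : Fin n → Ω → ℝ
  /-- the level of the covariate noise -/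
  sigmaX : ℝ
  /-- the standard deviation of the response noise -/
  sigmaY : ℝ
  /-- the explicit ridge regularisation parameter -/
  gamma : ℝ

namespace LMM

variable {Z Ω : Type*} [MeasurableSpace Z] [MeasurableSpace Ω] {p n : ℕ}

/-- The standing assumptions on the Latent Metric Model and on the response noise. -/
structure Valid [MetricSpace Z] (M : LMM Z Ω p n) : Prop where
  prob : IsProbabilityMeasure M.P
  compact_space : CompactSpace Z
  borel_space : BorelSpace Z
  mu_prob : IsProbabilityMeasure M.mu
  /-- the support of `mu` is the whole of `Z` -/
  full_support : M.mu.IsOpenPosMeasure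
  sigmaX_nonneg : 0 ≤ M.sigmaX
  sigmaY_nonneg : 0 ≤ M.sigmaY
  gamma_nonneg : 0 ≤ M.gamma
  z_meas : ∀ i, Measurable (M.z i)
  z_law : ∀ i, M.P.map (M.z i) = M.mu
  psi_sq : ∀ j z, MemLp (M.psi j z) 2 M.P
  /-- mean-square continuity -/
  psi_cont : ∀ j z,
    Tendsto (fun z' => ∫ ω, |M.psi j z ω - M.psi j z' ω| ^ 2 ∂M.P) (𝓝 z) (𝓝 0)
  psi_fourth : ∃ C : NNReal, ∀ j z, ∫⁻ ω, ‖M.psi j z ω‖ₑ ^ 4 ∂M.P ≤ C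
  E_meas : ∀ i j, Measurable (M.E i j)
  E_sq : ∀ i j, MemLp (M.E i j) 2 M.P
  E_mean : ∀ i j, ∫ ω, M.E i j ω ∂M.P = 0
  E_var : ∀ i j, ∫ ω, M.E i j ω ^ 2 ∂M.P = 1
  E_ident : ∀ i i' j, IdentDistrib (M.E i j) (M.E i' j) M.P M.P
  E_fourth : ∃ C : NNReal, ∀ i j, ∫⁻ ω, ‖M.E i j ω‖ₑ ^ 4 ∂M.P ≤ C
  eps_meas : ∀ i, Measurable (M.eps i)
  eps_sq : ∀ i, MemLp (M.eps i) 2 M.P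
  eps_mean : ∀ i, ∫ ω, M.eps i ω ∂M.P = 0
  eps_var : ∀ i, ∫ ω, M.eps i ω ^ 2 ∂M.P = M.sigmaY ^ 2
  eps_ident : ∀ i i', IdentDistrib (M.eps i) (M.eps i') M.P M.P
  /-- The random functions `psi j`, the latent positions `z i`, the entries `E i j` and the
  response noises `eps i` are all mutually independent. The randomness of `psi j` is
  carried by a σ-algebra `G j` for which `psi j` is jointly measurable in `(ω, z)`; this is what
  gives a meaning to `psi j (z i)` and to integrals of `psi j` over `Z` as random variables, and
  to independence between `psi j` as a random function and the other variables. -/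
  indep : ∃ G : Fin p → MeasurableSpace Ω,
    (∀ j, G j ≤ ‹MeasurableSpace Ω›) ∧
    (∀ j, Measurable[(G j).prod ‹MeasurableSpace Z›]
      (fun x : Ω × Z => M.psi j x.2 x.1)) ∧
    iIndep (Sum.elim G
      (Sum.elim (fun i : Fin n => MeasurableSpace.comap (M.z i) ‹MeasurableSpace Z›)
      (Sum.elim (fun q : Fin n × Fin p => MeasurableSpace.comap (M.E q.1 q.2) Real.measurableSpace)
        (fun i : Fin n => MeasurableSpace.comap (M.eps i) Real.measurableSpace)))) M.P

/-- The implicit kernel `(z, z') ↦ p⁻¹ E⟨psi z, psi z'⟩`. -/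
noncomputable def kernel (M : LMM Z Ω p n) (z z' : Z) : ℝ :=
  (p : ℝ)⁻¹ * ∫ ω, ∑ j, M.psi j z ω * M.psi j z' ω ∂M.P

end LMM

/-- The integral operator of the kernel `f` on `L²(mu)` has exactly `r` nonzero eigenvalues counted
with multiplicity, namely `lam 0 ≥ lam 1 ≥ ⋯ ≥ lam (r - 1) > 0`, and `u` is a corresponding
orthonormal system of continuous eigenfunctions. The last field says that the operator vanishes on
the orthogonal complement, that is, all the other members of an orthonormal basis of eigenfunctions
belong to the eigenvalue zero. -/
structure IsEigensystem {Z : Type*} [MeasurableSpace Z] [TopologicalSpace Z] (mu : Measure Z)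
    (f : Z → Z → ℝ) {r : ℕ} (lam : Fin r → ℝ) (u : Fin r → Z → ℝ) : Prop where
  pos : ∀ k, 0 < lam k
  antitone : Antitone lam
  continuous : ∀ k, Continuous (u k)
  orthonormal : ∀ k l, ∫ z, u k z * u l z ∂mu = if k = l then 1 else 0
  eigen : ∀ k z, ∫ z', f z z' * u k z' ∂mu = lam k * u k z
  complete : ∀ h : Z → ℝ, MemLp h 2 mu → (∀ k, ∫ z, h z * u k z ∂mu = 0) →
    ∀ᵐ z ∂mu, ∫ z', f z z' * h z' ∂mu = 0

/-- The feature map `phi z = (√(lam k) * u k z)_k`; its coordinates beyond the rank are zero and are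
left out. -/
noncomputable def featureMap {Z : Type*} {r : ℕ} (lam : Fin r → ℝ) (u : Fin r → Z → ℝ)
    (z : Z) : Fin r → ℝ :=
  fun k => Real.sqrt (lam k) * u k z

/-- The coefficient `β_k`: the supremum over `z` of the largest of `‖u(z)_{≤k}‖² / k`,
`‖phi(z)_{>k}‖² / tr Λ_{>k}` and `‖Λ_{>k}^{1/2} phi(z)_{>k}‖² / tr Λ_{>k}²`. For `k` equal to the
rank `r` the last two quotients are `0 / 0`, which counts as `0`. -/
noncomputable def betaCoef {Z : Type*} {r : ℕ} (lam : Fin r → ℝ) (u : Fin r → Z → ℝ)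
    (k : ℕ) : ℝ :=
  ⨆ z : Z, max ((∑ l : Fin r with l.val < k, u l z ^ 2) / k)
    (max
      ((∑ l : Fin r with k ≤ l.val, featureMap lam u z l ^ 2) /
        (∑ l : Fin r with k ≤ l.val, lam l))
      ((∑ l : Fin r with k ≤ l.val, lam l * featureMap lam u z l ^ 2) /
        (∑ l : Fin r with k ≤ l.val, lam l ^ 2)))

/-- `‖v‖²_D` for the diagonal matrix `D = diag(d)`. -/
def diagNormSq {r : ℕ} (d v : Fin r → ℝ) : ℝ := ∑ k, d k * v k ^ 2

/-- The spectral norm of a real square matrix. -/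
noncomputable def specNorm {n : ℕ} (B : Matrix (Fin n) (Fin n) ℝ) : ℝ :=
  ‖Matrix.toEuclideanCLM (n := Fin n) (𝕜 := ℝ) B‖

/-- The smallest eigenvalue `μ_n(B)` of a symmetric `n × n` matrix, `n ≥ 1`. -/
noncomputable def minEigenvalue {n : ℕ} (B : Matrix (Fin n) (Fin n) ℝ) : ℝ :=
  sInf (spectrum ℝ B)

namespace LMM

open Matrix

variable {Z Ω : Type*} [MeasurableSpace Z] [MeasurableSpace Ω] {p n r : ℕ}

/-- The matrix `E` of covariate noise, at the outcome `ω`. -/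
def noiseMat (M : LMM Z Ω p n) (ω : Ω) : Matrix (Fin n) (Fin p) ℝ :=
  Matrix.of fun i j => M.E i j ω

/-- The data matrix `X`, with rows `x_i = psi (z_i) + σ_x e_i`. -/
def dataMat (M : LMM Z Ω p n) (ω : Ω) : Matrix (Fin n) (Fin p) ℝ :=
  Matrix.of fun i j => M.psi j (M.z i ω) ω + M.sigmaX * M.E i j ω

/-- The matrix `Φ`, with rows `phi (z_i)`. -/
noncomputable def featureMat (M : LMM Z Ω p n) (lam : Fin r → ℝ) (u : Fin r → Z → ℝ) (ω : Ω) :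
    Matrix (Fin n) (Fin r) ℝ :=
  Matrix.of fun i k => featureMap lam u (M.z i ω) k

/-- The matrix `W_{jk} = (lam_k p)^{-1/2} ∫ psi_j u_k dmu`. -/
noncomputable def weightMat (M : LMM Z Ω p n) (lam : Fin r → ℝ) (u : Fin r → Z → ℝ) (ω : Ω) :
    Matrix (Fin p) (Fin r) ℝ :=
  Matrix.of fun j k => (Real.sqrt (lam k * p))⁻¹ * ∫ z, M.psi j z ω * u k z ∂M.mu

/-- `A = p⁻¹ X Xᵀ + n γ I`. -/
noncomputable def matA (M : LMM Z Ω p n) (ω : Ω) : Matrix (Fin n) (Fin n) ℝ :=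
  (p : ℝ)⁻¹ • (M.dataMat ω * (M.dataMat ω)ᵀ) + (n * M.gamma) • (1 : Matrix (Fin n) (Fin n) ℝ)

/-- `Δ = Φ (Wᵀ W - I) Φᵀ + p^{-1/2} σ_x (Φ Wᵀ Eᵀ + E W Φᵀ) + p⁻¹ σ_x² (E Eᵀ - p I)`. -/
noncomputable def matDelta (M : LMM Z Ω p n) (lam : Fin r → ℝ) (u : Fin r → Z → ℝ) (ω : Ω) :
    Matrix (Fin n) (Fin n) ℝ :=
  M.featureMat lam u ω * ((M.weightMat lam u ω)ᵀ * M.weightMat lam u ω - 1) *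
      (M.featureMat lam u ω)ᵀ +
    ((Real.sqrt p)⁻¹ * M.sigmaX) •
      (M.featureMat lam u ω * (M.weightMat lam u ω)ᵀ * (M.noiseMat ω)ᵀ +
        M.noiseMat ω * M.weightMat lam u ω * (M.featureMat lam u ω)ᵀ) +
    ((p : ℝ)⁻¹ * M.sigmaX ^ 2) •
      (M.noiseMat ω * (M.noiseMat ω)ᵀ - (p : ℝ) • (1 : Matrix (Fin n) (Fin n) ℝ))

/-- `K_{>k} = Φ_{>k} Φ_{>k}ᵀ`, formed from the columns of `Φ` after the first `k`. -/
noncomputable def tailGram (M : LMM Z Ω p n) (lam : Fin r → ℝ) (u : Fin r → Z → ℝ) (k : ℕ)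
    (ω : Ω) : Matrix (Fin n) (Fin n) ℝ :=
  Matrix.of fun i j =>
    ∑ l : Fin r with k ≤ l.val, M.featureMat lam u ω i l * M.featureMat lam u ω j l

/-- The event `C^{(k)} = {2 ‖Δ‖ ≥ μ_n(K_{>k}) + σ_x² + n γ}`. -/
def eventC (M : LMM Z Ω p n) (lam : Fin r → ℝ) (u : Fin r → Z → ℝ) (k : ℕ) : Set Ω :=
  {ω | minEigenvalue (M.tailGram lam u k ω) + M.sigmaX ^ 2 + n * M.gamma ≤
    2 * specNorm (M.matDelta lam u ω)}

/-- `θ̂(y) = Φᵀ A⁻¹ y`. -/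
noncomputable def thetaHat (M : LMM Z Ω p n) (lam : Fin r → ℝ) (u : Fin r → Z → ℝ) (ω : Ω)
    (y : Fin n → ℝ) : Fin r → ℝ :=
  (M.featureMat lam u ω)ᵀ *ᵥ ((M.matA ω)⁻¹ *ᵥ y)

/-- The bias term `B = ‖θ̂(Φ θ) - θ‖²_Λ`. -/
noncomputable def bias (M : LMM Z Ω p n) (lam : Fin r → ℝ) (u : Fin r → Z → ℝ)
    (theta : Fin r → ℝ) (ω : Ω) : ℝ :=
  diagNormSq lam (M.thetaHat lam u ω (M.featureMat lam u ω *ᵥ theta) - theta)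

/-- The variance term `V = E_ε ‖θ̂(ε)‖²_Λ`: the average is over the response noise only, with
everything else frozen at the outcome `ω`. -/
noncomputable def variance (M : LMM Z Ω p n) (lam : Fin r → ℝ) (u : Fin r → Z → ℝ) (ω : Ω) : ℝ :=
  ∫ ω', diagNormSq lam (M.thetaHat lam u ω fun i => M.eps i ω') ∂M.P

end LMM

/-! Write `U` for the matrix `(u_k (z_i))`, so that `Φ = U Λ^{1/2}`, and put `s = σ_x² + n γ`. The
argument has a deterministic half and a probabilistic half.

Deterministic half (`Matrix.ridge_bounds`). Almost surely `A = U Λ Uᵀ + s I + Δ`. Outside the event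
`C` one has `‖Δ‖ < s / 2`, so `A` is coercive and `‖A⁻¹‖ ≤ 2 / s`. Both errors are governed by `G =
Λ Uᵀ A⁻¹`: the variance is `σ_y²` times the squared Frobenius norm of `G`, and the bias is `‖G U Λ t
- Λ t‖²` with `t = Λ^{-1/2} θ`. The resolvent identity `U G = I - (s I + Δ) A⁻¹` bounds `U G` by an
absolute constant. If moreover `Uᵀ U ≥ (n / 2) I`, then `U` can be cancelled, whence `‖G‖² ≤ 32 /
n`, with no dependence on the size of the eigenvalues. Since `A⁻¹ U Λ = Gᵀ`, the same bound on `G`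
controls the bias.

Probabilistic half. The bound `Uᵀ U ≥ (n / 2) I` is a matrix Chernoff bound
(`Matrix.measureReal_lower_tail_le`): the rows of `U` are independent, isotropic by orthonormality,
and of squared length at most `β r`. The bound follows from Golden-Thompson, itself a consequence of
the Lie product formula and trace inequalities for powers `2 ^ k`.

The identity for `A` requires `ψ_j (z_i)` to equal its expansion in the `u_k`
(`LMM.Valid.ae_psi_eq`). By Bessel, the mean squared residuals of the `ψ_j` add up to `p` times the
integral of `f (z, z)`, minus `p ∑ λ_k`. This is zero because `f` is the finite sum `∑ λ_k u_k ⊗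
u_k`. Independence of `ψ_j` and `z_i` then allows evaluation at the random point. -/

/-! ### Lie product formula -/

/-- In a normed algebra, `f (1 / N) ^ N → exp C` when `f 0 = 1` and `f' 0 = C`. -/
theorem tendsto_pow_exp_of_hasDerivAt {𝔸 : Type*} [NormedRing 𝔸] [NormOneClass 𝔸]
    [NormedAlgebra ℝ 𝔸] [CompleteSpace 𝔸] {f : ℝ → 𝔸} {C : 𝔸} (h0 : f 0 = 1)
    (hf : HasDerivAt f C 0) :
    Tendsto (fun N : ℕ => f ((N : ℝ)⁻¹) ^ N) atTop (𝓝 (NormedSpace.exp C)) := by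
  let _ : NormedAlgebra ℚ 𝔸 := NormedAlgebra.restrictScalars ℚ ℝ 𝔸
  set g : ℝ → 𝔸 := fun t => NormedSpace.exp (t • C) with hg
  have hgd : HasDerivAt g C 0 := by
    simpa using hasDerivAt_exp_smul_const (𝕂 := ℝ) C 0
  have hgpow : ∀ N : ℕ, N ≠ 0 → g ((N : ℝ)⁻¹) ^ N = NormedSpace.exp C := by
    intro N hN
    simp only [hg]
    rw [← NormedSpace.exp_nsmul, ← Nat.cast_smul_eq_nsmul ℝ, smul_smul,
      mul_inv_cancel₀ (by exact_mod_cast hN), one_smul]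
  have hu : Tendsto (fun N : ℕ => (N : ℝ)⁻¹) atTop (𝓝[≠] 0) := by
    rw [tendsto_nhdsWithin_iff]
    refine ⟨tendsto_inv_atTop_nhds_zero_nat, ?_⟩
    filter_upwards [eventually_gt_atTop 0] with N hN
    simp [hN.ne']
  have slope_lim : ∀ {h : ℝ → 𝔸} {D : 𝔸}, HasDerivAt h D 0 →
      Tendsto (fun N : ℕ => (N : ℝ) • (h ((N : ℝ)⁻¹) - h 0)) atTop (𝓝 D) := by
    intro h D hh
    have := (hasDerivAt_iff_tendsto_slope.1 hh).comp hu
    refine this.congr fun N => ?_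
    simp [slope_def_module]
  have growth : ∀ {h : ℝ → 𝔸} {D : 𝔸}, h 0 = 1 → HasDerivAt h D 0 →
      ∀ᶠ N : ℕ in atTop, ‖h ((N : ℝ)⁻¹)‖ ≤ Real.exp ((‖D‖ + 1) / N) := by
    intro h D h1 hh
    have := (slope_lim hh).norm.eventually (gt_mem_nhds (lt_add_one ‖D‖))
    filter_upwards [this, eventually_gt_atTop 0] with N hN hN0
    have hNp : (0 : ℝ) < N := by exact_mod_cast hN0
    rw [norm_smul, Real.norm_of_nonneg hNp.le, h1] at hN
    have h2 : ‖h ((N : ℝ)⁻¹) - 1‖ ≤ (‖D‖ + 1) / N := by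
      rw [le_div_iff₀ hNp]; linarith
    calc ‖h ((N : ℝ)⁻¹)‖ = ‖(h ((N : ℝ)⁻¹) - 1) + 1‖ := by rw [sub_add_cancel]
      _ ≤ ‖h ((N : ℝ)⁻¹) - 1‖ + 1 := (norm_add_le _ _).trans (by rw [norm_one])
      _ ≤ (‖D‖ + 1) / N + 1 := by linarith
      _ ≤ _ := Real.add_one_le_exp _
  have hdiff : Tendsto (fun N : ℕ => (N : ℝ) • (f ((N : ℝ)⁻¹) - g ((N : ℝ)⁻¹))) atTop
      (𝓝 0) := by
    have hg0 : g 0 = 1 := by simp [hg]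
    have := (slope_lim hf).sub (slope_lim hgd)
    rw [sub_self] at this
    refine this.congr fun N => ?_
    rw [← smul_sub, h0, hg0]; congr 1; abel
  -- Used with `c = exp ((‖C‖ + 1) / N)`, for which `c ^ N` does not depend on `N`; the remaining
  -- factor `N ‖S - T‖` tends to zero because both curves have derivative `C` at zero.
  have telescope : ∀ (S T : 𝔸) (c : ℝ), 1 ≤ c → ‖S‖ ≤ c → ‖T‖ ≤ c → ∀ N : ℕ,
      ‖S ^ N - T ^ N‖ ≤ N * ‖S - T‖ * c ^ N := by
    intro S T c hc hS hT N
    induction N with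
    | zero => simp
    | succ N ih =>
      have e : S ^ (N + 1) - T ^ (N + 1) = S ^ N * (S - T) + (S ^ N - T ^ N) * T := by
        rw [pow_succ, pow_succ]; noncomm_ring
      have h1 : ‖S ^ N * (S - T)‖ ≤ c ^ N * ‖S - T‖ :=
        (norm_mul_le _ _).trans (by
          gcongr
          exact (norm_pow_le S N).trans (pow_le_pow_left₀ (norm_nonneg _) hS N))
      have h2 : ‖(S ^ N - T ^ N) * T‖ ≤ N * ‖S - T‖ * c ^ N * c :=
        (norm_mul_le _ _).trans (by gcongr)
      have h3 : c ^ N * ‖S - T‖ ≤ ‖S - T‖ * c ^ (N + 1) := by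
        rw [mul_comm]; gcongr; omega
      rw [e]
      refine (norm_add_le _ _).trans ?_
      push_cast
      rw [pow_succ] at h3 ⊢
      nlinarith
  have hlim : Tendsto (fun N : ℕ => f ((N : ℝ)⁻¹) ^ N - NormedSpace.exp C) atTop (𝓝 0) := by
    have hb : Tendsto (fun N : ℕ => ‖(N : ℝ) • (f ((N : ℝ)⁻¹) - g ((N : ℝ)⁻¹))‖ *
        Real.exp (‖C‖ + 1)) atTop (𝓝 0) := by
      simpa using hdiff.norm.mul_const (Real.exp (‖C‖ + 1))
    refine squeeze_zero_norm' ?_ hb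
    filter_upwards [growth h0 hf, growth (by simp [hg]) hgd, eventually_gt_atTop 0]
      with N h1 h2 hN
    have hNp : (0 : ℝ) < N := by exact_mod_cast hN
    rw [← hgpow N hN.ne', norm_smul, Real.norm_of_nonneg hNp.le]
    refine (telescope _ _ _ (Real.one_le_exp (by positivity)) h1 h2 N).trans_eq ?_
    rw [← Real.exp_nat_mul, mul_div_cancel₀ _ hNp.ne']
  simpa using hlim.add_const (NormedSpace.exp C)

/-- The Lie product formula. -/
theorem tendsto_exp_smul_mul_exp_smul_pow {𝔸 : Type*} [NormedRing 𝔸] [NormOneClass 𝔸]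
    [NormedAlgebra ℝ 𝔸] [CompleteSpace 𝔸] (A B : 𝔸) :
    Tendsto (fun N : ℕ => (NormedSpace.exp ((N : ℝ)⁻¹ • A) * NormedSpace.exp ((N : ℝ)⁻¹ • B)) ^ N)
      atTop (𝓝 (NormedSpace.exp (A + B))) := by
  refine tendsto_pow_exp_of_hasDerivAt
    (f := fun t : ℝ => NormedSpace.exp (t • A) * NormedSpace.exp (t • B)) (by simp) ?_
  have hA : HasDerivAt (fun t : ℝ => NormedSpace.exp (t • A)) A 0 := by
    simpa using hasDerivAt_exp_smul_const (𝕂 := ℝ) A 0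
  have hB : HasDerivAt (fun t : ℝ => NormedSpace.exp (t • B)) B 0 := by
    simpa using hasDerivAt_exp_smul_const (𝕂 := ℝ) B 0
  have h := hA.mul hB
  simp only [zero_smul, NormedSpace.exp_zero, mul_one, one_mul] at h
  exact h

/-! ### Trace inequalities and Golden-Thompson -/

namespace Matrix

variable {m : Type*} [Fintype m]

/-- Cauchy-Schwarz for the trace inner product. -/
theorem sq_trace_mul_le (A B : Matrix m m ℝ) :
    (A * B).trace ^ 2 ≤ (A * Aᵀ).trace * (B * Bᵀ).trace := by
  have h1 : (A * B).trace = ∑ q : m × m, A q.1 q.2 * Bᵀ q.1 q.2 := by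
    simp [Matrix.trace, Matrix.mul_apply, Fintype.sum_prod_type]
  have h2 : (A * Aᵀ).trace = ∑ q : m × m, A q.1 q.2 ^ 2 := by
    simp [Matrix.trace, Matrix.mul_apply, Fintype.sum_prod_type, sq]
  have h3 : (B * Bᵀ).trace = ∑ q : m × m, Bᵀ q.1 q.2 ^ 2 := by
    rw [trace_mul_comm]
    simp [Matrix.trace, Matrix.mul_apply, Fintype.sum_prod_type, sq]
  rw [h1, h2, h3]
  exact Finset.sum_mul_sq_le_sq_mul_sq _ _ _

variable [DecidableEq m]

theorem trace_pow_mul_comm (A B : Matrix m m ℝ) (N : ℕ) :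
    ((A * B) ^ N).trace = ((B * A) ^ N).trace := by
  cases N with
  | zero => simp
  | succ N =>
    have : ∀ N : ℕ, (A * B) ^ N * A = A * (B * A) ^ N := by
      intro N
      induction N with
      | zero => simp
      | succ N ih => rw [pow_succ, pow_succ, ← mul_assoc A, ← ih]; noncomm_ring
    rw [pow_succ, ← mul_assoc, this, mul_assoc, trace_mul_comm, mul_assoc, pow_succ]

/-- The trace of a power of `M` is dominated by the trace of a power of `M Mᵀ`, and the trace
of a power of a product of symmetric matrices obeys a Hölder-type inequality; exponents are powers
of two. -/
theorem trace_pow_two_pow_aux (k : ℕ) :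
    (∀ M : Matrix m m ℝ, |(M ^ 2 ^ (k + 1)).trace| ≤ ((M * Mᵀ) ^ 2 ^ k).trace) ∧
    (∀ P Q : Matrix m m ℝ, P.IsSymm → Q.IsSymm → ((P * Q) ^ 2 ^ k).trace ^ 2 ≤
      (P ^ 2 ^ (k + 1)).trace * (Q ^ 2 ^ (k + 1)).trace) := by
  have nonneg : ∀ (M : Matrix m m ℝ) (N : ℕ), 0 ≤ ((M * Mᵀ) ^ N).trace := fun M N =>
    ((posSemidef_self_mul_conjTranspose M).pow N).trace_nonneg
  induction k with
  | zero =>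
    refine ⟨fun M => ?_, fun P Q hP hQ => ?_⟩
    · have h := sq_trace_mul_le M M
      have h0 := nonneg M 1
      simp only [zero_add, pow_one, pow_zero, sq M] at h h0 ⊢
      exact abs_le_of_sq_le_sq (by nlinarith) h0
    · have h := sq_trace_mul_le P Q
      rw [hP.eq, hQ.eq] at h
      simpa [sq P, sq Q] using h
  | succ k ih =>
    -- The two claims feed each other. The first at level `k + 1` is the first at level `k` for `M ^
    -- 2`, followed by the second for `Mᵀ M` and `M Mᵀ`, whose powers have equal traces. The second
    -- is the first at level `k` for `P Q`, followed by the second for `P ^ 2` and `Q ^ 2`.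
    obtain ⟨ihS, ihL⟩ := ih
    have S : ∀ M : Matrix m m ℝ, |(M ^ 2 ^ (k + 2)).trace| ≤ ((M * Mᵀ) ^ 2 ^ (k + 1)).trace := by
      intro M
      have h1 := ihS (M ^ 2)
      rw [← pow_mul, show 2 * 2 ^ (k + 1) = 2 ^ (k + 2) by ring] at h1
      have h2 : ((M ^ 2 * (M ^ 2)ᵀ) ^ 2 ^ k).trace = (((Mᵀ * M) * (M * Mᵀ)) ^ 2 ^ k).trace := by
        rw [show M ^ 2 * (M ^ 2)ᵀ = M * (M * Mᵀ * Mᵀ) by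
          rw [sq, transpose_mul]; noncomm_ring, trace_pow_mul_comm]
        rw [show M * Mᵀ * Mᵀ * M = (M * Mᵀ) * (Mᵀ * M) by noncomm_ring, trace_pow_mul_comm]
      have h3 := ihL (Mᵀ * M) (M * Mᵀ) (isSymm_transpose_mul_self M) (isSymm_mul_transpose_self M)
      rw [trace_pow_mul_comm Mᵀ M, ← sq] at h3
      exact h1.trans (h2 ▸ le_of_abs_le (abs_le_of_sq_le_sq h3 (nonneg _ _)))
    refine ⟨S, fun P Q hP hQ => ?_⟩
    have h1 := ihS (P * Q)
    have h2 : ((P * Q * (P * Q)ᵀ) ^ 2 ^ k).trace = ((P ^ 2 * Q ^ 2) ^ 2 ^ k).trace := by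
      rw [transpose_mul, hP.eq, hQ.eq, show P * Q * (Q * P) = P * (Q ^ 2 * P) by
        rw [sq]; noncomm_ring, trace_pow_mul_comm, show Q ^ 2 * P * P = Q ^ 2 * P ^ 2 by
        rw [sq P]; noncomm_ring, trace_pow_mul_comm]
    have h3 := ihL (P ^ 2) (Q ^ 2) (hP.pow 2) (hQ.pow 2)
    rw [h2] at h1
    rw [← pow_mul, ← pow_mul, show 2 * 2 ^ (k + 1) = 2 ^ (k + 1 + 1) by ring] at h3
    refine le_trans ?_ h3
    rw [← sq_abs]
    exact pow_le_pow_left₀ (abs_nonneg _) h1 2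

/-- Each halving of the exponent replaces `X Y` by `(X Y)(X Y)ᵀ = X Y² X`, which is `X² Y²` up to
cyclic permutation, so induction applies to the squares. -/
theorem trace_mul_pow_two_pow_le {X Y : Matrix m m ℝ} (hX : X.IsSymm) (hY : Y.IsSymm) (k : ℕ) :
    ((X * Y) ^ 2 ^ k).trace ≤ (X ^ 2 ^ k * Y ^ 2 ^ k).trace := by
  induction k generalizing X Y with
  | zero => simp
  | succ k ih =>
    have h1 := le_of_abs_le ((trace_pow_two_pow_aux k).1 (X * Y))
    have h2 : ((X * Y * (X * Y)ᵀ) ^ 2 ^ k).trace = ((X ^ 2 * Y ^ 2) ^ 2 ^ k).trace := by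
      rw [transpose_mul, hX.eq, hY.eq, show X * Y * (Y * X) = X * (Y ^ 2 * X) by
        rw [sq]; noncomm_ring, trace_pow_mul_comm, show Y ^ 2 * X * X = Y ^ 2 * X ^ 2 by
        rw [sq X]; noncomm_ring, trace_pow_mul_comm]
    have h3 := ih (hX.pow 2) (hY.pow 2)
    rw [← pow_mul, ← pow_mul, show 2 * 2 ^ k = 2 ^ (k + 1) by ring] at h3
    exact h1.trans (h2.le.trans h3)

open scoped Norms.Operator in
theorem tendsto_exp_mul_exp_pow [Nonempty m] (A B : Matrix m m ℝ) :
    Tendsto (fun N : ℕ => (NormedSpace.exp ((N : ℝ)⁻¹ • A) * NormedSpace.exp ((N : ℝ)⁻¹ • B)) ^ N)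
      atTop (𝓝 (NormedSpace.exp (A + B))) :=
  tendsto_exp_smul_mul_exp_smul_pow A B

/-- The **Golden-Thompson inequality** for real symmetric matrices. -/
theorem trace_exp_add_le [Nonempty m] {A B : Matrix m m ℝ} (hA : A.IsSymm) (hB : B.IsSymm) :
    (NormedSpace.exp (A + B)).trace ≤ (NormedSpace.exp A * NormedSpace.exp B).trace := by
  -- The trace inequality is available for exponents `2 ^ k` only, so the Lie formula is used along
  -- that subsequence.
  have h2 : Tendsto (fun k : ℕ => 2 ^ k) atTop atTop :=
    tendsto_pow_atTop_atTop_of_one_lt one_lt_two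
  have hlim := ((continuous_id.matrix_trace (n := m) (R := ℝ)).tendsto _).comp
    ((tendsto_exp_mul_exp_pow A B).comp h2)
  refine le_of_tendsto hlim (Eventually.of_forall fun k => ?_)
  have hpow : ∀ C : Matrix m m ℝ,
      NormedSpace.exp ((((2 ^ k : ℕ) : ℝ))⁻¹ • C) ^ 2 ^ k = NormedSpace.exp C := by
    intro C
    rw [← exp_nsmul, ← Nat.cast_smul_eq_nsmul ℝ, smul_smul,
      mul_inv_cancel₀ (by positivity), one_smul]
  have := trace_mul_pow_two_pow_le (hA.smul (((2 ^ k : ℕ) : ℝ))⁻¹).exp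
    (hB.smul (((2 ^ k : ℕ) : ℝ))⁻¹).exp k
  rw [hpow, hpow] at this
  exact this

end Matrix

/-! ### Spectral estimates for the exponential of a symmetric matrix -/

namespace Matrix

variable {m : Type*} [Fintype m]

open scoped MatrixOrder Norms.L2Operator in
theorem PosSemidef.trace_mul_nonneg {P Q : Matrix m m ℝ} (hP : P.PosSemidef)
    (hQ : Q.PosSemidef) : 0 ≤ (P * Q).trace := by
  classical
  obtain ⟨C, rfl⟩ := CStarAlgebra.nonneg_iff_eq_star_mul_self.mp hP.nonneg
  rw [mul_assoc, trace_mul_comm]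
  exact (hQ.mul_mul_conjTranspose_same C).trace_nonneg

variable [DecidableEq m]

theorem IsHermitian.eq_eigenvectorUnitary_mul {A : Matrix m m ℝ} (hA : A.IsHermitian) :
    A = (hA.eigenvectorUnitary : Matrix m m ℝ) * diagonal hA.eigenvalues *
      (hA.eigenvectorUnitary : Matrix m m ℝ)ᴴ := by
  conv_lhs => rw [hA.spectral_theorem, Unitary.conjStarAlgAut_apply]
  rfl

theorem IsHermitian.exp_neg_eq {A : Matrix m m ℝ} (hA : A.IsHermitian) :
    NormedSpace.exp (-A) = (hA.eigenvectorUnitary : Matrix m m ℝ) *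
      diagonal (fun i => Real.exp (-hA.eigenvalues i)) *
      (hA.eigenvectorUnitary : Matrix m m ℝ)ᴴ := by
  have hu : (hA.eigenvectorUnitary : Matrix m m ℝ)⁻¹ =
      (hA.eigenvectorUnitary : Matrix m m ℝ)ᴴ :=
    inv_eq_right_inv (Unitary.coe_mul_star_self hA.eigenvectorUnitary)
  have hU : IsUnit (hA.eigenvectorUnitary : Matrix m m ℝ) :=
    IsUnit.of_mul_eq_one _ (Unitary.coe_mul_star_self hA.eigenvectorUnitary)
  have h : -A = (hA.eigenvectorUnitary : Matrix m m ℝ) *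
      diagonal (fun i => -hA.eigenvalues i) * (hA.eigenvectorUnitary : Matrix m m ℝ)⁻¹ := by
    conv_lhs => rw [hA.eq_eigenvectorUnitary_mul]
    rw [hu, ← neg_mul, ← mul_neg, diagonal_neg]
  rw [h, exp_conj _ _ hU, exp_diagonal, hu]
  congr 3
  funext i
  rw [Pi.coe_exp, Real.exp_eq_exp_ℝ]

theorem IsHermitian.trace_exp_neg {A : Matrix m m ℝ} (hA : A.IsHermitian) :
    (NormedSpace.exp (-A)).trace = ∑ i, Real.exp (-hA.eigenvalues i) := by
  have hu : (hA.eigenvectorUnitary : Matrix m m ℝ)ᴴ * (hA.eigenvectorUnitary : Matrix m m ℝ) = 1 :=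
    Unitary.coe_star_mul_self hA.eigenvectorUnitary
  rw [hA.exp_neg_eq, trace_mul_comm, ← mul_assoc, hu, one_mul, trace_diagonal]

theorem IsHermitian.posSemidef_sub_exp_neg {A : Matrix m m ℝ} (hA : A.IsHermitian) (a b : ℝ)
    (h : ∀ i, Real.exp (-hA.eigenvalues i) ≤ a + b * hA.eigenvalues i) :
    (a • (1 : Matrix m m ℝ) + b • A - NormedSpace.exp (-A)).PosSemidef := by
  have hu : (hA.eigenvectorUnitary : Matrix m m ℝ) * (hA.eigenvectorUnitary : Matrix m m ℝ)ᴴ = 1 :=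
    Unitary.coe_mul_star_self hA.eigenvectorUnitary
  have e : a • (1 : Matrix m m ℝ) + b • A - NormedSpace.exp (-A) =
      (hA.eigenvectorUnitary : Matrix m m ℝ) *
      diagonal (fun i => a + b * hA.eigenvalues i - Real.exp (-hA.eigenvalues i)) *
      (hA.eigenvectorUnitary : Matrix m m ℝ)ᴴ := by
    have hd : diagonal (fun i => a + b * hA.eigenvalues i - Real.exp (-hA.eigenvalues i)) =
        a • (1 : Matrix m m ℝ) + b • diagonal hA.eigenvalues -
          diagonal (fun i => Real.exp (-hA.eigenvalues i)) := by
      ext i j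
      by_cases hij : i = j
      · subst hij; simp
      · simp [hij]
    rw [hd, hA.exp_neg_eq, mul_sub, sub_mul, mul_add, add_mul]
    congr 2
    · rw [Matrix.mul_smul, Matrix.smul_mul, mul_one, hu]
    · rw [Matrix.mul_smul, Matrix.smul_mul, ← hA.eq_eigenvectorUnitary_mul]
  rw [e]
  exact (PosSemidef.diagonal fun i => sub_nonneg.2 (h i)).mul_mul_conjTranspose_same _

/-- The chord bound `e^{-A} ≤ 1 - (1 - e⁻¹) A` for `0 ≤ A ≤ 1`. -/
theorem PosSemidef.posSemidef_chord_sub_exp_neg {A : Matrix m m ℝ} (hA : A.PosSemidef)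
    (ht : A.trace ≤ 1) :
    ((1 : ℝ) • (1 : Matrix m m ℝ) + (-(1 - Real.exp (-1))) • A -
      NormedSpace.exp (-A)).PosSemidef := by
  refine hA.isHermitian.posSemidef_sub_exp_neg _ _ fun i => ?_
  have h0 := hA.eigenvalues_nonneg
  have h1 : hA.isHermitian.eigenvalues i ≤ 1 := by
    rw [hA.isHermitian.trace_eq_sum_eigenvalues] at ht
    exact (Finset.single_le_sum (f := fun j => hA.isHermitian.eigenvalues j)
      (fun j _ => h0 j) (Finset.mem_univ i)).trans (by simpa using ht)
  set t := hA.isHermitian.eigenvalues i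
  -- Convexity of `exp` on `[-1, 0]`, at the point `-t = (1 - t) · 0 + t · (-1)`.
  have := convexOn_exp.2 (Set.mem_univ (0 : ℝ)) (Set.mem_univ (-1 : ℝ))
    (sub_nonneg.2 h1) (h0 i) (sub_add_cancel 1 _)
  simp only [smul_eq_mul, mul_zero, zero_add, Real.exp_zero, mul_neg, mul_one] at this
  change Real.exp (-t) ≤ 1 - t + t * Real.exp (-1) at this
  linarith

/-- A direction with Rayleigh quotient below `a` forces an eigenvalue at most `a`, and that
eigenvalue alone contributes `exp (-a)` to the trace. This turns a small eigenvalue into a large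
trace, ready for Markov's inequality. -/
theorem IsHermitian.exp_neg_le_trace_exp_neg {A : Matrix m m ℝ} (hA : A.IsHermitian) {a : ℝ}
    {y : m → ℝ} (hy : y ⬝ᵥ (A *ᵥ y) < a * (y ⬝ᵥ y)) :
    Real.exp (-a) ≤ (NormedSpace.exp (-A)).trace := by
  obtain ⟨i, hi⟩ : ∃ i, hA.eigenvalues i ≤ a := by
    by_contra! h
    have hpsd : (A - a • 1).PosSemidef := by
      have hu : (hA.eigenvectorUnitary : Matrix m m ℝ) *
          (hA.eigenvectorUnitary : Matrix m m ℝ)ᴴ = 1 :=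
        Unitary.coe_mul_star_self hA.eigenvectorUnitary
      have e : A - a • 1 = (hA.eigenvectorUnitary : Matrix m m ℝ) *
          diagonal (fun i => hA.eigenvalues i - a) * (hA.eigenvectorUnitary : Matrix m m ℝ)ᴴ := by
        have hd : diagonal (fun i => hA.eigenvalues i - a) =
            diagonal hA.eigenvalues - a • (1 : Matrix m m ℝ) := by
          ext i j
          by_cases hij : i = j
          · subst hij; simp
          · simp [hij]
        rw [hd, mul_sub, sub_mul, ← hA.eq_eigenvectorUnitary_mul, Matrix.mul_smul, Matrix.smul_mul, mul_one,
          hu]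
      rw [e]
      exact (PosSemidef.diagonal fun i => sub_nonneg.2 (h i).le).mul_mul_conjTranspose_same _
    have := hpsd.dotProduct_mulVec_nonneg y
    simp only [star_trivial, sub_mulVec, smul_mulVec, one_mulVec, dotProduct_sub,
      dotProduct_smul, smul_eq_mul] at this
    linarith
  rw [hA.trace_exp_neg]
  exact (Real.exp_le_exp.2 (neg_le_neg hi)).trans
    (Finset.single_le_sum (f := fun j => Real.exp (-hA.eigenvalues j))
      (fun j _ => (Real.exp_pos _).le) (Finset.mem_univ i))

open scoped Norms.Operator in
theorem continuous_exp_neg : Continuous fun A : Matrix m m ℝ => NormedSpace.exp (-A) := by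
  let _ : NormedAlgebra ℚ (Matrix m m ℝ) := NormedAlgebra.restrictScalars ℚ ℝ _
  exact NormedSpace.exp_continuous.comp continuous_neg

/-- Continuity on a compact box of matrices. It serves only to make the entries of random
exponentials integrable, so the value of `K` is immaterial. -/
theorem exists_bound_exp_neg (C : ℝ) : ∃ K : ℝ, ∀ A : Matrix m m ℝ, (∀ a b, |A a b| ≤ C) →
    ∀ a b, |NormedSpace.exp (-A) a b| ≤ K := by
  have hK : IsCompact (Set.pi Set.univ fun _ : m => Set.pi Set.univ fun _ : m => Set.Icc (-C) C) :=
    isCompact_univ_pi fun _ => isCompact_univ_pi fun _ => isCompact_Icc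
  have hc : Continuous fun A : m → m → ℝ => ∑ a, ∑ b, |NormedSpace.exp (-(Matrix.of A)) a b| :=
    continuous_finsetSum _ fun a _ => continuous_finsetSum _ fun b _ =>
      ((continuous_exp_neg.comp continuous_id).matrix_elem a b).abs
  obtain ⟨K, hK⟩ := hK.bddAbove_image hc.continuousOn
  refine ⟨K, fun A hA a b => ?_⟩
  have h1 := hK ⟨A, fun a _ b _ => abs_le.1 (hA a b), rfl⟩
  refine le_trans ?_ h1
  refine le_trans ?_ (Finset.single_le_sum (f := fun a => ∑ b, |NormedSpace.exp (-(Matrix.of A)) a b|)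
    (fun _ _ => Finset.sum_nonneg fun _ _ => abs_nonneg _) (Finset.mem_univ a))
  exact Finset.single_le_sum (f := fun b => |NormedSpace.exp (-(Matrix.of A)) a b|)
    (fun _ _ => abs_nonneg _) (Finset.mem_univ b)

end Matrix

/-! ### Matrix Chernoff bound -/

namespace Matrix

variable {m Ω ι : Type*} [MeasurableSpace Ω]

/-- The rescaled second moment matrix `L⁻¹ ∑ i ∈ s, v_i v_iᵀ`. -/
noncomputable def scaledGram (L : ℝ) (s : Finset ι) (v : ι → m → ℝ) : Matrix m m ℝ :=
  ∑ i ∈ s, L⁻¹ • vecMulVec (v i) (v i)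

theorem scaledGram_apply (L : ℝ) (s : Finset ι) (v : ι → m → ℝ) (a b : m) :
    scaledGram L s v a b = ∑ i ∈ s, L⁻¹ * (v i a * v i b) := by
  simp [scaledGram, Matrix.sum_apply, vecMulVec_apply]

variable [Fintype m]

theorem scaledGram_posSemidef {L : ℝ} (hL : 0 ≤ L) (s : Finset ι) (v : ι → m → ℝ) :
    (scaledGram L s v).PosSemidef := by
  refine posSemidef_sum s fun i _ => ?_
  have := (posSemidef_vecMulVec_self_star (v i)).smul (inv_nonneg.2 hL)
  simpa using this

theorem abs_scaledGram_le {L : ℝ} (hL : 0 < L) (s : Finset ι) {v : ι → m → ℝ}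
    (hv : ∀ i ∈ s, v i ⬝ᵥ v i ≤ L) (a b : m) : |scaledGram L s v a b| ≤ s.card := by
  rw [scaledGram_apply]
  refine (Finset.abs_sum_le_sum_abs _ _).trans ?_
  rw [← nsmul_one, ← Finset.sum_const]
  refine Finset.sum_le_sum fun i hi => ?_
  have h : ∀ c, v i c ^ 2 ≤ L := fun c => by
    refine le_trans ?_ (hv i hi)
    rw [sq]
    exact Finset.single_le_sum (f := fun c => v i c * v i c) (fun _ _ => mul_self_nonneg _)
      (Finset.mem_univ c)
  rw [abs_mul, abs_of_pos (inv_pos.2 hL), inv_mul_le_iff₀ hL, mul_one, abs_le]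
  constructor <;> nlinarith [h a, h b, sq_nonneg (v i a + v i b), sq_nonneg (v i a - v i b)]

theorem measurable_of_continuous_entries {α : Type*} [MeasurableSpace α] {A : α → Matrix m m ℝ}
    (hA : ∀ a b, Measurable fun x => A x a b) {f : Matrix m m ℝ → ℝ} (hf : Continuous f) :
    Measurable fun x => f (A x) := by
  have h1 : Measurable fun x => (fun a b => A x a b : m → m → ℝ) :=
    measurable_pi_iff.2 fun a => measurable_pi_iff.2 fun b => hA a b
  have h2 : Continuous fun B : m → m → ℝ => f (Matrix.of B) := hf.comp continuous_id
  exact h2.measurable.comp h1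

theorem PosSemidef.integral {P : Measure Ω} {A : Ω → Matrix m m ℝ}
    (hA : ∀ ω, (A ω).PosSemidef) (hint : ∀ a b, Integrable (fun ω => A ω a b) P) :
    (Matrix.of fun a b => ∫ ω, A ω a b ∂P).PosSemidef := by
  refine .of_dotProduct_mulVec_nonneg ?_ fun x => ?_
  · ext a b
    simp only [conjTranspose_apply, of_apply, star_trivial]
    exact integral_congr_ae (ae_of_all _ fun ω => (hA ω).isHermitian.apply a b)
  · have : star x ⬝ᵥ ((Matrix.of fun a b => ∫ ω, A ω a b ∂P) *ᵥ x) =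
        ∫ ω, star x ⬝ᵥ (A ω *ᵥ x) ∂P := by
      simp only [dotProduct, mulVec, star_trivial, of_apply]
      rw [integral_finsetSum _ fun a _ => (integrable_finsetSum _ fun b _ =>
        (hint a b).mul_const _).const_mul _]
      refine Finset.sum_congr rfl fun a _ => ?_
      rw [integral_const_mul, integral_finsetSum _ fun b _ => (hint a b).mul_const _]
      simp only [integral_mul_const]
    rw [this]
    exact integral_nonneg fun ω => (hA ω).dotProduct_mulVec_nonneg x

variable [DecidableEq m]

theorem integrable_exp_neg_apply {P : Measure Ω} [IsProbabilityMeasure P]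
    {A : Ω → Matrix m m ℝ} (hA : ∀ a b, Measurable fun ω => A ω a b) {C : ℝ}
    (hC : ∀ ω a b, |A ω a b| ≤ C) (a b : m) :
    Integrable (fun ω => NormedSpace.exp (-A ω) a b) P := by
  obtain ⟨K, hK⟩ := exists_bound_exp_neg (m := m) C
  refine Integrable.of_bound (C := K) ?_ (ae_of_all _ fun ω => hK _ (hC ω) a b)
  exact (measurable_of_continuous_entries hA
    (continuous_exp_neg.matrix_elem a b)).aestronglyMeasurable

section Chernoff

variable {P : Measure Ω} [IsProbabilityMeasure P] {v : ι → Ω → m → ℝ} {L : ℝ}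

/-- Golden-Thompson splits off one summand at a time, and independence replaces its exponential by
the mean `Qm`. Each summand `L⁻¹ v vᵀ` lies between `0` and `I` and has mean `L⁻¹ I`, so the chord
bound gives `Qm ≤ (1 - (1 - e⁻¹) / L) I`: every observation costs one scalar factor. -/
theorem integral_trace_exp_neg_scaledGram_le [Nonempty m] (hv : ∀ i, Measurable (v i))
    (hind : iIndepFun v P) (hL : 0 < L) (hvL : ∀ i ω, v i ω ⬝ᵥ v i ω ≤ L)
    (hI : ∀ i a b, ∫ ω, v i ω a * v i ω b ∂P = if a = b then 1 else 0) (s : Finset ι) :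
    ∫ ω, (NormedSpace.exp (-scaledGram L s fun i => v i ω)).trace ∂P ≤
      Fintype.card m * Real.exp (-((1 - Real.exp (-1)) / L)) ^ s.card := by
  classical
  have hm : ∀ (s : Finset ι) (a b : m),
      Measurable fun ω => scaledGram L s (fun i => v i ω) a b := by
    intro s a b
    simp only [scaledGram_apply]
    have hc : ∀ i c, Measurable fun ω => v i ω c := fun i c => measurable_pi_iff.1 (hv i) c
    fun_prop
  have hint : ∀ (s : Finset ι) (a b : m),
      Integrable (fun ω => NormedSpace.exp (-scaledGram L s fun i => v i ω) a b) P :=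
    fun s => integrable_exp_neg_apply (hm s)
      (fun ω a b => abs_scaledGram_le hL s (fun i _ => hvL i ω) a b)
  have hsymm : ∀ (s : Finset ι) (ω : Ω), (-scaledGram L s fun i => v i ω).IsSymm := fun s ω => by
    have := (scaledGram_posSemidef hL.le s fun i => v i ω).isHermitian.neg
    rwa [IsHermitian, conjTranspose_eq_transpose_of_trivial] at this
  have hpsd : ∀ (s : Finset ι) (ω : Ω),
      (NormedSpace.exp (-scaledGram L s fun i => v i ω)).PosSemidef := by
    intro s ω
    have hA := (scaledGram_posSemidef hL.le s fun i => v i ω).isHermitian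
    rw [hA.exp_neg_eq]
    exact (PosSemidef.diagonal fun i => (Real.exp_pos _).le).mul_mul_conjTranspose_same _
  induction s using Finset.induction_on with
  | empty => simp [scaledGram]
  | insert i s hi ih =>
    set F : Ω → Matrix m m ℝ := fun ω => NormedSpace.exp (-scaledGram L s fun i => v i ω) with hF
    set Q : Ω → Matrix m m ℝ := fun ω => NormedSpace.exp (-scaledGram L {i} fun i => v i ω) with hQ
    set Qm : Matrix m m ℝ := Matrix.of fun a b => ∫ ω, Q ω a b ∂P with hQm
    set κ : ℝ := 1 - (1 - Real.exp (-1)) / L with hκ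
    have hFQ : ∀ a b c d, IndepFun (fun ω => F ω a b) (fun ω => Q ω c d) P := by
      intro a b c d
      have h1 := hind.indepFun_finset s {i} (by simpa using hi) hv
      have hcoe : ∀ (t : Finset ι) (ω : Ω), scaledGram L t (fun i => v i ω) =
          scaledGram L Finset.univ (fun j : t => v j ω) := by
        intro t ω
        simp only [scaledGram]
        exact (Finset.sum_coe_sort t fun i => L⁻¹ • vecMulVec (v i ω) (v i ω)).symm
      have hmeas : ∀ (t : Finset ι) (a b : m), Measurable fun y : t → m → ℝ =>
          NormedSpace.exp (-scaledGram L Finset.univ y) a b := by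
        intro t a b
        refine measurable_of_continuous_entries (fun c d => ?_)
          (continuous_exp_neg.matrix_elem a b)
        simp only [scaledGram_apply]
        fun_prop
      have h2 := h1.comp (hmeas s a b) (hmeas {i} c d)
      simpa only [hF, hQ, hcoe, Function.comp_def] using h2
    have hprod : ∀ a b c d, Integrable (fun ω => F ω a b * Q ω c d) P := fun a b c d =>
      (hFQ a b c d).integrable_mul (hint s a b) (hint {i} c d)
    have htr : ∀ A B : Matrix m m ℝ, (A * B).trace = ∑ a, ∑ b, A a b * B b a := fun A B => by
      simp [Matrix.trace, Matrix.mul_apply]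
    have hQpsd : (κ • (1 : Matrix m m ℝ) - Qm).PosSemidef := by
      have hch := fun ω => (scaledGram_posSemidef hL.le {i}
        fun i => v i ω).posSemidef_chord_sub_exp_neg (by
          simp only [scaledGram, Finset.sum_singleton, trace_smul, trace_vecMulVec, smul_eq_mul]
          rw [inv_mul_le_iff₀ hL, mul_one]
          exact hvL i ω)
      have hvint : ∀ a b, Integrable (fun ω => scaledGram L {i} (fun i => v i ω) a b) P :=
        fun a b => Integrable.of_bound (C := ({i} : Finset ι).card)
          (hm {i} a b).aestronglyMeasurable
          (ae_of_all _ fun ω => abs_scaledGram_le hL {i} (fun i _ => hvL i ω) a b)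
      have h := PosSemidef.integral hch (P := P) (fun a b => by
        simp only [sub_apply, add_apply, smul_apply, smul_eq_mul]
        exact ((integrable_const _).add ((hvint a b).const_mul _)).sub (hint {i} a b))
      convert h using 1
      ext a b
      simp only [sub_apply, add_apply, smul_apply, smul_eq_mul, of_apply, hQm]
      have hi1 : Integrable (fun _ : Ω => 1 * (1 : Matrix m m ℝ) a b) P := integrable_const _
      have hi2 : Integrable (fun ω => -(1 - Real.exp (-1)) *
          scaledGram L {i} (fun i => v i ω) a b) P := (hvint a b).const_mul _
      have hi3 : Integrable (fun ω => 1 * (1 : Matrix m m ℝ) a b + -(1 - Real.exp (-1)) *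
          scaledGram L {i} (fun i => v i ω) a b) P := hi1.add hi2
      rw [integral_sub hi3 (hint {i} a b), integral_add hi1 hi2, integral_const_mul]
      simp only [scaledGram_apply, Finset.sum_singleton, integral_const_mul, hI, integral_const,
        probReal_univ, one_smul, one_apply, hκ, hQ]
      split_ifs
      · simp; ring
      · simp
    have hFtr : Integrable (fun ω => (F ω).trace) P :=
      integrable_finsetSum _ fun a _ => hint s a a
    calc ∫ ω, (NormedSpace.exp (-scaledGram L (insert i s) fun i => v i ω)).trace ∂P
        ≤ ∫ ω, (F ω * Q ω).trace ∂P := by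
          refine integral_mono (integrable_finsetSum _ fun a _ => hint _ a a) ?_ fun ω => ?_
          · simp only [htr]
            exact integrable_finsetSum _ fun a _ => integrable_finsetSum _ fun b _ => hprod _ _ _ _
          · have hsum : (-scaledGram L (insert i s) fun i => v i ω) =
                -scaledGram L s (fun i => v i ω) + -scaledGram L {i} (fun i => v i ω) := by
              simp only [scaledGram]
              rw [Finset.sum_insert hi, Finset.sum_singleton]; abel
            simp only [hsum]
            exact trace_exp_add_le (hsymm s ω) (hsymm {i} ω)
      _ = ∫ ω, (F ω * Qm).trace ∂P := by
          simp only [htr]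
          rw [integral_finsetSum _ fun a _ => integrable_finsetSum _ fun b _ => hprod _ _ _ _,
            integral_finsetSum _ fun a _ => integrable_finsetSum _ fun b _ =>
              (hint s a b).mul_const _]
          refine Finset.sum_congr rfl fun a _ => ?_
          rw [integral_finsetSum _ fun b _ => hprod _ _ _ _,
            integral_finsetSum _ fun b _ => (hint s a b).mul_const _]
          refine Finset.sum_congr rfl fun b _ => ?_
          rw [(hFQ a b b a).integral_fun_mul_eq_mul_integral (hint s a b).aestronglyMeasurable
            (hint {i} b a).aestronglyMeasurable, integral_mul_const]
          rfl
      _ ≤ ∫ ω, κ * (F ω).trace ∂P := by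
          refine integral_mono ?_ (hFtr.const_mul κ) fun ω => ?_
          · simp only [htr]
            exact integrable_finsetSum _ fun a _ => integrable_finsetSum _ fun b _ =>
              (hint s a b).mul_const _
          · have := (hpsd s ω).trace_mul_nonneg hQpsd
            rw [mul_sub, trace_sub, Matrix.mul_smul, mul_one, trace_smul, smul_eq_mul] at this
            simpa using this
      _ = κ * ∫ ω, (F ω).trace ∂P := integral_const_mul _ _
      _ ≤ Real.exp (-((1 - Real.exp (-1)) / L)) * ∫ ω, (F ω).trace ∂P := by
          refine mul_le_mul_of_nonneg_right ?_ (integral_nonneg fun ω => (hpsd s ω).trace_nonneg)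
          have := Real.add_one_le_exp (-((1 - Real.exp (-1)) / L))
          rw [hκ]; linarith
      _ ≤ Real.exp (-((1 - Real.exp (-1)) / L)) *
          (Fintype.card m * Real.exp (-((1 - Real.exp (-1)) / L)) ^ s.card) :=
          mul_le_mul_of_nonneg_left ih (Real.exp_pos _).le
      _ = _ := by rw [Finset.card_insert_of_notMem hi, pow_succ]; ring

/-- **Matrix Chernoff bound** for the lower tail of the smallest eigenvalue of an empirical second
moment matrix of independent bounded isotropic vectors. -/
theorem measureReal_lower_tail_le [Nonempty m] [Fintype ι] (hv : ∀ i, Measurable (v i))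
    (hind : iIndepFun v P) (hL : 0 < L) (hvL : ∀ i ω, v i ω ⬝ᵥ v i ω ≤ L)
    (hI : ∀ i a b, ∫ ω, v i ω a * v i ω b ∂P = if a = b then 1 else 0) :
    P.real {ω | ∃ y : m → ℝ, ∑ i, (v i ω ⬝ᵥ y) ^ 2 < Fintype.card ι / 2 * (y ⬝ᵥ y)} ≤
      Fintype.card m * Real.exp (-(Fintype.card ι / (8 * L))) := by
  set N : ℝ := (Fintype.card ι : ℝ) with hN
  set T : Ω → ℝ := fun ω => (NormedSpace.exp (-scaledGram L Finset.univ fun i => v i ω)).trace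
    with hT
  have hT0 : ∀ ω, 0 ≤ T ω := fun ω => by
    simp only [hT]
    rw [(scaledGram_posSemidef hL.le Finset.univ fun i => v i ω).isHermitian.trace_exp_neg]
    exact Finset.sum_nonneg fun i _ => (Real.exp_pos _).le
  have hTint : Integrable T P := by
    refine integrable_finsetSum _ fun a _ => integrable_exp_neg_apply (fun a b => ?_)
      (fun ω a b => abs_scaledGram_le hL Finset.univ (fun i _ => hvL i ω) a b) a a
    simp only [scaledGram_apply]
    have hc : ∀ i c, Measurable fun ω => v i ω c := fun i c => measurable_pi_iff.1 (hv i) c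
    fun_prop
  have hsub : {ω | ∃ y : m → ℝ, ∑ i, (v i ω ⬝ᵥ y) ^ 2 < N / 2 * (y ⬝ᵥ y)} ⊆
      {ω | Real.exp (-(N / (2 * L))) ≤ T ω} := by
    rintro ω ⟨y, hy⟩
    refine (scaledGram_posSemidef hL.le Finset.univ
      fun i => v i ω).isHermitian.exp_neg_le_trace_exp_neg (y := y) ?_
    have : y ⬝ᵥ (scaledGram L Finset.univ (fun i => v i ω) *ᵥ y) =
        L⁻¹ * ∑ i, (v i ω ⬝ᵥ y) ^ 2 := by
      simp only [scaledGram, sum_mulVec, dotProduct_sum, smul_mulVec, dotProduct_smul, smul_eq_mul,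
        Finset.mul_sum, vecMulVec_mulVec]
      refine Finset.sum_congr rfl fun i _ => ?_
      simp [dotProduct_comm y, sq]
    rw [this]
    calc L⁻¹ * ∑ i, (v i ω ⬝ᵥ y) ^ 2 < L⁻¹ * (N / 2 * (y ⬝ᵥ y)) :=
          mul_lt_mul_of_pos_left hy (inv_pos.2 hL)
      _ = N / (2 * L) * (y ⬝ᵥ y) := by field_simp
  have hmk := mul_meas_ge_le_integral_of_nonneg (ae_of_all P hT0) hTint (Real.exp (-(N / (2 * L))))
  have hE := integral_trace_exp_neg_scaledGram_le hv hind hL hvL hI Finset.univ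
  have h1 : P.real {ω | Real.exp (-(N / (2 * L))) ≤ T ω} ≤ Real.exp (N / (2 * L)) *
      (Fintype.card m * Real.exp (-((1 - Real.exp (-1)) / L)) ^ Fintype.card ι) := by
    rw [Real.exp_neg (N / (2 * L)), inv_mul_le_iff₀ (Real.exp_pos _), ← Real.exp_neg] at hmk
    rw [Finset.card_univ] at hE
    exact hmk.trans (mul_le_mul_of_nonneg_left hE (Real.exp_pos _).le)
  refine (measureReal_mono hsub).trans (h1.trans ?_)
  rw [← Real.exp_nat_mul, mul_left_comm, ← Real.exp_add]
  refine mul_le_mul_of_nonneg_left (Real.exp_le_exp.2 ?_) (Nat.cast_nonneg _)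
  -- Markov contributes `N / (2 L)` to the exponent and the mean contributes `-(1 - e⁻¹) N / L`. The
  -- total is `(e⁻¹ - 1/2) N / L`, and `3/8 - 1/2 = -1/8`.
  have he : Real.exp (-1) ≤ 3 / 8 := by
    rw [Real.exp_neg, inv_le_comm₀ (Real.exp_pos _) (by norm_num)]
    linarith [Real.exp_one_gt_d9]
  have hNL : 0 ≤ N / L := by positivity
  have e1 : N / (2 * L) + N * -((1 - Real.exp (-1)) / L) =
      N / L * (Real.exp (-1) - 1 / 2) := by field_simp; ring
  have e2 : -(N / (8 * L)) = N / L * (-(1 / 8)) := by field_simp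
  rw [e1, e2]
  exact mul_le_mul_of_nonneg_left (by linarith) hNL

end Chernoff

end Matrix

/-! ### Deterministic bounds for ridge regression -/

namespace Matrix

section Ridge

variable {m r : Type*} [Fintype m] [Fintype r]

theorem dotProduct_self_eq_norm_sq (x : m → ℝ) : x ⬝ᵥ x = ‖WithLp.toLp 2 x‖ ^ 2 := by
  rw [EuclideanSpace.norm_sq_eq]
  simp [dotProduct, sq]

theorem abs_dotProduct_le_norm (x y : m → ℝ) :
    |x ⬝ᵥ y| ≤ ‖WithLp.toLp 2 x‖ * ‖WithLp.toLp 2 y‖ := by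
  refine abs_le_of_sq_le_sq ?_ (by positivity)
  rw [mul_pow, ← dotProduct_self_eq_norm_sq, ← dotProduct_self_eq_norm_sq]
  simpa [dotProduct, sq] using Finset.sum_mul_sq_le_sq_mul_sq Finset.univ x y

theorem norm_mulVec_transpose_le (G : Matrix r m ℝ) {C : ℝ} (hC : 0 ≤ C)
    (hG : ∀ w, ‖WithLp.toLp 2 (G *ᵥ w)‖ ≤ C * ‖WithLp.toLp 2 w‖) (y : r → ℝ) :
    ‖WithLp.toLp 2 (Gᵀ *ᵥ y)‖ ≤ C * ‖WithLp.toLp 2 y‖ := by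
  set a := ‖WithLp.toLp 2 (Gᵀ *ᵥ y)‖ with ha
  have h1 : a ^ 2 = y ⬝ᵥ (G *ᵥ (Gᵀ *ᵥ y)) := by
    rw [ha, ← dotProduct_self_eq_norm_sq, dotProduct_mulVec y, ← mulVec_transpose]
  have h2 := (le_abs_self _).trans (abs_dotProduct_le_norm y (G *ᵥ (Gᵀ *ᵥ y)))
  have h3 := hG (Gᵀ *ᵥ y)
  rw [← h1] at h2
  have hy := norm_nonneg (WithLp.toLp 2 y)
  have ha0 : 0 ≤ a := norm_nonneg _
  rcases ha0.eq_or_lt with h0 | h0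
  · rw [← h0]; positivity
  · have : a * a ≤ C * ‖WithLp.toLp 2 y‖ * a := by
      calc a * a = a ^ 2 := (sq a).symm
        _ ≤ ‖WithLp.toLp 2 y‖ * ‖WithLp.toLp 2 (G *ᵥ (Gᵀ *ᵥ y))‖ := h2
        _ ≤ ‖WithLp.toLp 2 y‖ * (C * a) := by gcongr
        _ = _ := by ring
    exact le_of_mul_le_mul_right this h0

/-- The rows of `G` are the vectors `Gᵀ e_k`, each of length at most `C`. Counting rows rather than
columns is what gives the variance a factor `r` instead of the number of observations. -/
theorem sum_sq_le_of_norm_mulVec_le (G : Matrix r m ℝ) {C : ℝ} (hC : 0 ≤ C)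
    (hG : ∀ w, ‖WithLp.toLp 2 (G *ᵥ w)‖ ≤ C * ‖WithLp.toLp 2 w‖) :
    ∑ k, ∑ i, G k i ^ 2 ≤ Fintype.card r * C ^ 2 := by
  classical
  have h : ∀ k, ∑ i, G k i ^ 2 ≤ C ^ 2 := by
    intro k
    have h1 := norm_mulVec_transpose_le G hC hG (Pi.single k (1 : ℝ) : r → ℝ)
    have h2 : ‖WithLp.toLp 2 (Pi.single k (1 : ℝ) : r → ℝ)‖ = 1 := by
      have := dotProduct_self_eq_norm_sq (Pi.single k (1 : ℝ) : r → ℝ)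
      rw [dotProduct_single, Pi.single_eq_same, one_mul] at this
      exact (pow_eq_one_iff_of_nonneg (norm_nonneg _) two_ne_zero).1 this.symm
    rw [h2, mul_one] at h1
    have h3 := pow_le_pow_left₀ (norm_nonneg _) h1 2
    rw [← dotProduct_self_eq_norm_sq] at h3
    simpa [dotProduct, sq, mulVec_single] using h3
  calc ∑ k, ∑ i, G k i ^ 2 ≤ ∑ _k : r, C ^ 2 := Finset.sum_le_sum fun k _ => h k
    _ = _ := by simp

variable [DecidableEq m] [DecidableEq r]

/-- Perturbation of `K = U Λ Uᵀ` by `s I + Δ` with `‖Δ‖ ≤ s / 2`: the perturbed matrix is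
coercive. -/
theorem norm_le_of_perturbed_gram {U : Matrix m r ℝ} {lam : r → ℝ} (hlam : ∀ k, 0 < lam k)
    {D : Matrix m m ℝ} {s : ℝ} (hs : 0 < s)
    (hD : ∀ x, ‖WithLp.toLp 2 (D *ᵥ x)‖ ≤ s / 2 * ‖WithLp.toLp 2 x‖) (x : m → ℝ) :
    ‖WithLp.toLp 2 x‖ ≤ 2 / s *
      ‖WithLp.toLp 2 ((U * diagonal lam * Uᵀ + s • (1 : Matrix m m ℝ) + D) *ᵥ x)‖ := by
  set A := U * diagonal lam * Uᵀ + s • (1 : Matrix m m ℝ) + D with hA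
  set a := ‖WithLp.toLp 2 x‖ with ha
  have h1 : x ⬝ᵥ (A *ᵥ x) = x ⬝ᵥ ((U * diagonal lam * Uᵀ) *ᵥ x) + s * a ^ 2 + x ⬝ᵥ (D *ᵥ x) := by
    rw [hA, add_mulVec, add_mulVec, dotProduct_add, dotProduct_add, smul_mulVec, one_mulVec,
      dotProduct_smul, dotProduct_self_eq_norm_sq, smul_eq_mul]
  have h2 : 0 ≤ x ⬝ᵥ ((U * diagonal lam * Uᵀ) *ᵥ x) := by
    have := ((PosSemidef.diagonal fun k => (hlam k).le).mul_mul_conjTranspose_same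
      U).dotProduct_mulVec_nonneg x
    simpa using this
  have h3 := abs_le.1 (abs_dotProduct_le_norm x (D *ᵥ x))
  have h4 := (le_abs_self _).trans (abs_dotProduct_le_norm x (A *ᵥ x))
  have h5 := hD x
  have ha0 : 0 ≤ a := norm_nonneg _
  rcases ha0.eq_or_lt with h0 | h0
  · rw [← h0]; positivity
  · have h6 : a * ‖WithLp.toLp 2 (D *ᵥ x)‖ ≤ a * (s / 2 * a) := by gcongr
    have h7 : s / 2 * a * a ≤ ‖WithLp.toLp 2 (A *ᵥ x)‖ * a := by nlinarith [h3.1]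
    have h8 := le_of_mul_le_mul_right h7 h0
    rw [div_mul_eq_mul_div, le_div_iff₀ hs]
    linarith

/-- Invertibility, variance and bias bounds for ridge regression with a perturbed Gram matrix. -/
theorem ridge_bounds {U : Matrix m r ℝ} {lam : r → ℝ} (hlam : ∀ k, 0 < lam k)
    {D : Matrix m m ℝ} (hDs : D.IsSymm) {s ν : ℝ} (hs : 0 < s) (hν : 0 < ν)
    (hD : ∀ x, ‖WithLp.toLp 2 (D *ᵥ x)‖ ≤ s / 2 * ‖WithLp.toLp 2 x‖)
    (hU : ∀ y : r → ℝ, ν / 2 * (y ⬝ᵥ y) ≤ (U *ᵥ y) ⬝ᵥ (U *ᵥ y))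
    {A : Matrix m m ℝ} (hA : A = U * diagonal lam * Uᵀ + s • (1 : Matrix m m ℝ) + D) :
    IsUnit A.det ∧
    ∑ k, ∑ i, (diagonal lam * Uᵀ * A⁻¹) k i ^ 2 ≤ 32 * (Fintype.card r / ν) ∧
    ∀ t : r → ℝ,
      ∑ k, ((diagonal lam * Uᵀ * A⁻¹) *ᵥ (U *ᵥ (diagonal lam *ᵥ t)) - diagonal lam *ᵥ t) k ^ 2 ≤
        144 * (s ^ 2 / ν ^ 2) * ∑ k, t k ^ 2 := by
  set G := diagonal lam * Uᵀ * A⁻¹ with hG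
  -- A bound for the operator norm of `G`: `‖U G w‖ ≤ (1 + 3) ‖w‖`, and cancelling `U` costs `2 / ν`
  -- on squares, hence `4² · 2 / ν`.
  set C := Real.sqrt (32 / ν) with hCdef
  have hC0 : 0 ≤ C := Real.sqrt_nonneg _
  have hC2 : C ^ 2 = 32 / ν := Real.sq_sqrt (by positivity)
  have hcoer : ∀ x, ‖WithLp.toLp 2 x‖ ≤ 2 / s * ‖WithLp.toLp 2 (A *ᵥ x)‖ := fun x => by
    rw [hA]; exact norm_le_of_perturbed_gram hlam hs hD x
  have hdet : IsUnit A.det := by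
    rw [← isUnit_iff_isUnit_det, ← mulVec_injective_iff_isUnit]
    intro x y hxy
    have h := hcoer (x - y)
    rw [mulVec_sub, show A *ᵥ x = A *ᵥ y from hxy, sub_self] at h
    have h0 : ‖WithLp.toLp 2 (x - y)‖ ≤ 0 := by simpa using h
    have h1 : WithLp.toLp 2 (x - y) = 0 := norm_le_zero_iff.1 h0
    have h2 : x - y = 0 := congrArg WithLp.ofLp h1
    exact sub_eq_zero.1 h2
  have hinv : ∀ w, A *ᵥ (A⁻¹ *ᵥ w) = w := fun w => by
    rw [mulVec_mulVec, mul_nonsing_inv _ hdet, one_mulVec]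
  have hx : ∀ w, ‖WithLp.toLp 2 (A⁻¹ *ᵥ w)‖ ≤ 2 / s * ‖WithLp.toLp 2 w‖ := fun w => by
    simpa [hinv] using hcoer (A⁻¹ *ᵥ w)
  -- Since `U G = U Λ Uᵀ A⁻¹ = (A - s I - D) A⁻¹`, no inverse of `Λ` ever appears.
  have hres : ∀ w, U *ᵥ (G *ᵥ w) = w - (s • (A⁻¹ *ᵥ w) + D *ᵥ (A⁻¹ *ᵥ w)) := fun w => by
    have h := hinv w
    nth_rewrite 1 [hA] at h
    rw [add_mulVec, add_mulVec, smul_mulVec, one_mulVec, mulVec_mulVec, add_assoc] at h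
    rw [hG, mulVec_mulVec, ← Matrix.mul_assoc, ← Matrix.mul_assoc, eq_sub_iff_add_eq]
    exact h
  have hpert : ∀ x, ‖WithLp.toLp 2 (s • x + D *ᵥ x)‖ ≤ 3 / 2 * s * ‖WithLp.toLp 2 x‖ := by
    intro x
    rw [WithLp.toLp_add, WithLp.toLp_smul]
    refine (norm_add_le _ _).trans ?_
    rw [norm_smul, Real.norm_of_nonneg hs.le]
    linarith [hD x]
  have hUn : ∀ y : r → ℝ, ν / 2 * ‖WithLp.toLp 2 y‖ ^ 2 ≤ ‖WithLp.toLp 2 (U *ᵥ y)‖ ^ 2 :=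
    fun y => by simpa only [← dotProduct_self_eq_norm_sq] using hU y
  have hGn : ∀ w, ‖WithLp.toLp 2 (G *ᵥ w)‖ ≤ C * ‖WithLp.toLp 2 w‖ := by
    intro w
    have h1 : ‖WithLp.toLp 2 (U *ᵥ (G *ᵥ w))‖ ≤ 4 * ‖WithLp.toLp 2 w‖ := by
      rw [hres, WithLp.toLp_sub]
      refine (norm_sub_le _ _).trans ?_
      have h2 := hpert (A⁻¹ *ᵥ w)
      have h3 : 3 / 2 * s * ‖WithLp.toLp 2 (A⁻¹ *ᵥ w)‖ ≤
          3 / 2 * s * (2 / s * ‖WithLp.toLp 2 w‖) := by gcongr; exact hx w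
      have h4 : 3 / 2 * s * (2 / s * ‖WithLp.toLp 2 w‖) = 3 * ‖WithLp.toLp 2 w‖ := by
        field_simp
      linarith
    refine (sq_le_sq₀ (norm_nonneg _) (by positivity)).1 ?_
    have h5 := (hUn (G *ᵥ w)).trans (pow_le_pow_left₀ (norm_nonneg _) h1 2)
    rw [mul_pow, hC2, div_mul_eq_mul_div, le_div_iff₀ hν]
    linarith
  refine ⟨hdet, ?_, fun t => ?_⟩
  · refine (sum_sq_le_of_norm_mulVec_le G hC0 hGn).trans_eq ?_
    rw [hC2]; ring
  · set w := U *ᵥ (diagonal lam *ᵥ t) with hw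
    set b := G *ᵥ w - diagonal lam *ᵥ t with hb
    have hAs : A⁻¹ᵀ = A⁻¹ := by
      rw [transpose_nonsing_inv]
      congr 1
      rw [hA, transpose_add, transpose_add, hDs.eq, transpose_smul, transpose_one, transpose_mul,
        transpose_mul, transpose_transpose, diagonal_transpose, Matrix.mul_assoc]
    -- Symmetry of `A` identifies `A⁻¹ U Λ` with `Gᵀ`. Bounding `A⁻¹` by `2 / s` here would lose the
    -- factor `s` that the bias must keep.
    have hGt : A⁻¹ *ᵥ w = Gᵀ *ᵥ t := by
      rw [hw, hG, transpose_mul, hAs, transpose_mul, transpose_transpose, diagonal_transpose,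
        mulVec_mulVec, mulVec_mulVec, Matrix.mul_assoc]
    have h1 : ‖WithLp.toLp 2 (U *ᵥ b)‖ ≤ 3 / 2 * s * (C * ‖WithLp.toLp 2 t‖) := by
      rw [hb, mulVec_sub, ← hw, hres, sub_sub_cancel_left, WithLp.toLp_neg, norm_neg]
      refine (hpert _).trans ?_
      gcongr
      rw [hGt]
      exact norm_mulVec_transpose_le G hC0 hGn t
    have h2 := (hUn b).trans (pow_le_pow_left₀ (norm_nonneg _) h1 2)
    have e : ∀ y : r → ℝ, ∑ k, y k ^ 2 = ‖WithLp.toLp 2 y‖ ^ 2 := fun y => by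
      rw [← dotProduct_self_eq_norm_sq]; simp [dotProduct, sq]
    rw [e, e]
    rw [mul_pow, mul_pow C, hC2, mul_pow] at h2
    -- `144 = (3/2)² · 32 · 2`: the perturbation `s I + D`, the bound on `G`, and the cancellation
    -- of `U`.
    have e2 : 144 * (s ^ 2 / ν ^ 2) * ‖WithLp.toLp 2 t‖ ^ 2 =
        ((3 / 2) ^ 2 * s ^ 2 * (32 / ν * ‖WithLp.toLp 2 t‖ ^ 2)) / (ν / 2) := by
      field_simp; ring
    rw [e2, le_div_iff₀ (by positivity)]
    linarith

end Ridge

end Matrix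

/-! ### Expansion of the random functions in the eigenfunctions -/

section SecondOrderProcess

variable {Z Ω : Type*} [MeasurableSpace Ω] {P : Measure Ω}

theorem inner_toLp_eq_integral {f g : Ω → ℝ} (hf : MemLp f 2 P) (hg : MemLp g 2 P) :
    inner ℝ (hf.toLp f) (hg.toLp g) = ∫ ω, f ω * g ω ∂P := by
  rw [L2.inner_def]
  refine integral_congr_ae ?_
  filter_upwards [hf.coeFn_toLp, hg.coeFn_toLp] with ω h1 h2
  rw [h1, h2]
  simp [mul_comm]

/-- The second moment kernel of a mean-square continuous process is jointly continuous. -/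
theorem continuous_integral_mul_of_meanSquare [TopologicalSpace Z] {X : Z → Ω → ℝ}
    (hX : ∀ z, MemLp (X z) 2 P)
    (hc : ∀ z, Tendsto (fun z' => ∫ ω, |X z ω - X z' ω| ^ 2 ∂P) (𝓝 z) (𝓝 0)) :
    Continuous fun q : Z × Z => ∫ ω, X q.1 ω * X q.2 ω ∂P := by
  have hcont : Continuous fun z => (hX z).toLp (X z) := by
    refine continuous_iff_continuousAt.2 fun z => ?_
    rw [ContinuousAt, tendsto_iff_norm_sub_tendsto_zero]
    have h : ∀ z', ‖(hX z').toLp (X z') - (hX z).toLp (X z)‖ =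
        Real.sqrt (∫ ω, |X z ω - X z' ω| ^ 2 ∂P) := by
      intro z'
      rw [norm_sub_rev, ← MemLp.toLp_sub, ← Real.sqrt_sq (norm_nonneg _),
        ← real_inner_self_eq_norm_sq, inner_toLp_eq_integral]
      simp only [sq_abs, Pi.sub_apply, ← sq]
    simp only [h]
    simpa using (hc z).sqrt
  simp only [← inner_toLp_eq_integral (hX _) (hX _)]
  exact (hcont.comp continuous_fst).inner (hcont.comp continuous_snd)

end SecondOrderProcess

/-- For fixed `x`, the difference `R` of the two sides as functions of `y` is orthogonal to every
`u_k`, so completeness makes the operator kill it. Evaluated at `x`, this says that `R` is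
orthogonal to `f x`, hence to itself. -/
theorem IsEigensystem.kernel_eq {Z : Type*} [MetricSpace Z] [CompactSpace Z] [MeasurableSpace Z]
    [BorelSpace Z] {mu : Measure Z} [IsProbabilityMeasure mu] [mu.IsOpenPosMeasure]
    {f : Z → Z → ℝ} (hf : Continuous fun q : Z × Z => f q.1 q.2) {r : ℕ} {lam : Fin r → ℝ}
    {u : Fin r → Z → ℝ} (h : IsEigensystem mu f lam u) (x y : Z) :
    f x y = ∑ k, lam k * (u k x * u k y) := by
  have hint : ∀ {g : Z → ℝ}, Continuous g → Integrable g mu := fun hg =>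
    hg.integrable_of_hasCompactSupport (HasCompactSupport.of_compactSpace _)
  have hu := h.continuous
  have hfx : ∀ z, Continuous (f z) := fun z => hf.comp (Continuous.prodMk_right z)
  set R : Z → ℝ := fun y => f x y - ∑ k, lam k * (u k x * u k y) with hR
  have hRc : Continuous R := by fun_prop
  have hRu : ∀ l, ∫ y, R y * u l y ∂mu = 0 := by
    intro l
    have e : ∀ y, R y * u l y = f x y * u l y - ∑ k, lam k * u k x * (u k y * u l y) := fun y => by
      simp only [hR, sub_mul, Finset.sum_mul]
      congr 1
      exact Finset.sum_congr rfl fun k _ => by ring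
    simp only [e]
    rw [integral_sub (hint (by fun_prop)) (hint (by fun_prop)), h.eigen,
      integral_finsetSum _ fun k _ => hint (by fun_prop)]
    simp [integral_const_mul, h.orthonormal]
  have hae := h.complete R (hRc.memLp_of_hasCompactSupport (HasCompactSupport.of_compactSpace _)) hRu
  have hTc : Continuous fun z => ∫ y, f z y * R y ∂mu := by
    have : Continuous (Function.uncurry fun z y => f z y * R y) := by
      exact hf.mul (hRc.comp continuous_snd)
    simpa using continuous_parametric_integral_of_continuous (μ := mu) this isCompact_univ
  have hT : ∫ y, f x y * R y ∂mu = 0 := by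
    -- Full support upgrades an almost everywhere identity between continuous functions to one valid
    -- at the given point `x`.
    have := (hTc.ae_eq_iff_eq (μ := mu) continuous_const).1 hae
    exact congrFun this x
  have hsq : ∫ y, R y ^ 2 ∂mu = 0 := by
    have e : ∀ y, R y ^ 2 = f x y * R y - ∑ k, lam k * u k x * (R y * u k y) := fun y => by
      rw [sq]
      nth_rewrite 1 [hR]
      simp only [sub_mul, Finset.sum_mul]
      congr 1
      exact Finset.sum_congr rfl fun k _ => by ring
    simp only [e]
    rw [integral_sub (hint (by fun_prop)) (hint (by fun_prop)), hT,
      integral_finsetSum _ fun k _ => hint (by fun_prop)]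
    simp [integral_const_mul, hRu]
  have h0 : (fun y => R y ^ 2) =ᵐ[mu] 0 :=
    (integral_eq_zero_iff_of_nonneg (fun y => sq_nonneg (R y)) (hint (by fun_prop))).1 hsq
  have h1 := congrFun (((hRc.pow 2).ae_eq_iff_eq (μ := mu) continuous_const).1 h0) y
  exact sub_eq_zero.1 (pow_eq_zero_iff two_ne_zero |>.1 h1)

section KarhunenLoeve

variable {Z Ω : Type*} [MetricSpace Z] [CompactSpace Z] [MeasurableSpace Z] [BorelSpace Z]
  [MeasurableSpace Ω] {P : Measure Ω} {mu : Measure Z} {X : Z → Ω → ℝ}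

theorem memLp_two_prod_mul {w : Z → ℝ} (hw : Continuous w)
    (hXm : Measurable fun q : Ω × Z => X q.2 q.1)
    (h : MemLp (fun q : Ω × Z => X q.2 q.1) 2 (P.prod mu)) :
    MemLp (fun q : Ω × Z => X q.2 q.1 * w q.2) 2 (P.prod mu) := by
  obtain ⟨K, hK⟩ := isCompact_univ.exists_bound_of_continuousOn hw.continuousOn
  refine h.of_le_mul (c := K)
    (hXm.mul (hw.measurable.comp measurable_snd)).aestronglyMeasurable (ae_of_all _ fun q => ?_)
  rw [norm_mul, mul_comm]
  exact mul_le_mul_of_nonneg_right (hK _ (Set.mem_univ _)) (norm_nonneg _)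

variable [IsProbabilityMeasure P] [IsProbabilityMeasure mu]

theorem memLp_two_prod_of_continuous (hXm : Measurable fun q : Ω × Z => X q.2 q.1)
    (hX : ∀ z, MemLp (X z) 2 P) (hc : Continuous fun q : Z × Z => ∫ ω, X q.1 ω * X q.2 ω ∂P) :
    MemLp (fun q : Ω × Z => X q.2 q.1) 2 (P.prod mu) := by
  rw [memLp_two_iff_integrable_sq hXm.aestronglyMeasurable,
    integrable_prod_iff' (hXm.pow_const 2).aestronglyMeasurable]
  refine ⟨ae_of_all _ fun z => (hX z).integrable_sq, ?_⟩
  have hd : Continuous fun z => ∫ ω, X z ω * X z ω ∂P :=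
    hc.comp (continuous_id.prodMk continuous_id)
  refine (hd.integrable_of_hasCompactSupport (HasCompactSupport.of_compactSpace _)).congr ?_
  exact ae_of_all _ fun z => integral_congr_ae (ae_of_all _ fun ω => by
    simp only [norm_pow, Real.norm_eq_abs, sq_abs]; rw [sq])

theorem ae_memLp_two_slice {Y : Ω × Z → ℝ} (hY : Measurable Y) (h : MemLp Y 2 (P.prod mu)) :
    ∀ᵐ ω ∂P, MemLp (fun z => Y (ω, z)) 2 mu := by
  filter_upwards [h.integrable_sq.prod_right_ae] with ω hω
  exact (memLp_two_iff_integrable_sq (hY.comp measurable_prodMk_left).aestronglyMeasurable).2 hω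

theorem memLp_two_coefficient {w : Z → ℝ} (hw : Continuous w)
    (hXm : Measurable fun q : Ω × Z => X q.2 q.1)
    (h : MemLp (fun q : Ω × Z => X q.2 q.1) 2 (P.prod mu)) :
    MemLp (fun ω => ∫ z, X z ω * w z ∂mu) 2 P := by
  have hY := memLp_two_prod_mul hw hXm h
  have hYm : Measurable fun q : Ω × Z => X q.2 q.1 * w q.2 :=
    hXm.mul (hw.measurable.comp measurable_snd)
  have hm : AEStronglyMeasurable (fun ω => ∫ z, X z ω * w z ∂mu) P :=
    (hYm.stronglyMeasurable.integral_prod_right (ν := mu)).aestronglyMeasurable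
  rw [memLp_two_iff_integrable_sq hm]
  refine (hY.integrable_sq.integral_prod_left).mono' (hm.pow 2) ?_
  filter_upwards [ae_memLp_two_slice hYm hY] with ω hω
  -- Jensen's inequality under `mu`: the squared coefficient is at most the integral of the square.
  have h1 := variance_nonneg (fun z => X z ω * w z) mu
  rw [variance_eq_sub hω] at h1
  simp only [Pi.pow_apply] at h1
  rw [Real.norm_of_nonneg (sq_nonneg _)]
  linarith

/-- Fubini turns the second moment of a coefficient into the quadratic form of the second moment
kernel. Summed over the `ψ_j` with `w = u_k`, that form equals `p λ_k`. -/
theorem integral_coefficient_sq {w : Z → ℝ} (hw : Continuous w)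
    (hXm : Measurable fun q : Ω × Z => X q.2 q.1) (hX : ∀ z, MemLp (X z) 2 P)
    (h : MemLp (fun q : Ω × Z => X q.2 q.1) 2 (P.prod mu)) :
    ∫ ω, (∫ z, X z ω * w z ∂mu) ^ 2 ∂P =
      ∫ z, (∫ z', (∫ ω, X z ω * X z' ω ∂P) * w z' ∂mu) * w z ∂mu := by
  have hY := memLp_two_prod_mul hw hXm h
  have hcoef := memLp_two_coefficient (mu := mu) hw hXm h
  have hi1 : Integrable (fun q : Ω × Z => (∫ z, X z q.1 * w z ∂mu) * (X q.2 q.1 * w q.2))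
      (P.prod mu) := (hcoef.comp_fst mu).integrable_mul hY
  calc ∫ ω, (∫ z, X z ω * w z ∂mu) ^ 2 ∂P
      = ∫ ω, ∫ z', (∫ z, X z ω * w z ∂mu) * (X z' ω * w z') ∂mu ∂P := by
        refine integral_congr_ae (ae_of_all _ fun ω => ?_)
        simp only [integral_const_mul, sq]
    _ = ∫ z', ∫ ω, (∫ z, X z ω * w z ∂mu) * (X z' ω * w z') ∂P ∂mu :=
        integral_integral_swap hi1
    _ = _ := by
        refine integral_congr_ae (ae_of_all _ fun z' => ?_)
        have hi2 : Integrable (fun q : Ω × Z => X z' q.1 * (X q.2 q.1 * w q.2)) (P.prod mu) :=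
          ((hX z').comp_fst mu).integrable_mul hY
        have e : ∀ ω, (∫ z, X z ω * w z ∂mu) * (X z' ω * w z') =
            (∫ z, X z' ω * (X z ω * w z) ∂mu) * w z' := fun ω => by
          rw [integral_const_mul]; ring
        simp only [e]
        rw [integral_mul_const, integral_integral_swap hi2]
        congr 1
        refine integral_congr_ae (ae_of_all _ fun z => ?_)
        simp only
        rw [← integral_mul_const]
        simp only [mul_assoc]

/-- Bessel's identity for the residual of the expansion of a process along an orthonormal system. -/
theorem integral_residual_sq {r : ℕ} {u : Fin r → Z → ℝ} (hu : ∀ k, Continuous (u k))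
    (ho : ∀ k l, ∫ z, u k z * u l z ∂mu = if k = l then 1 else 0)
    (hXm : Measurable fun q : Ω × Z => X q.2 q.1)
    (h : MemLp (fun q : Ω × Z => X q.2 q.1) 2 (P.prod mu)) :
    Integrable (fun q : Ω × Z => (X q.2 q.1 - ∑ k, (∫ z, X z q.1 * u k z ∂mu) * u k q.2) ^ 2)
      (P.prod mu) ∧
    ∫ q : Ω × Z, (X q.2 q.1 - ∑ k, (∫ z, X z q.1 * u k z ∂mu) * u k q.2) ^ 2 ∂P.prod mu =
      ∫ z, (∫ ω, X z ω * X z ω ∂P) ∂mu - ∑ k, ∫ ω, (∫ z, X z ω * u k z ∂mu) ^ 2 ∂P := by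
  have hint : ∀ {g : Z → ℝ}, Continuous g → MemLp g 2 mu := fun hg =>
    hg.memLp_of_hasCompactSupport (HasCompactSupport.of_compactSpace _)
  have hcoef := fun k => memLp_two_coefficient (mu := mu) (hu k) hXm h
  have hcu : ∀ k, MemLp (fun q : Ω × Z => (∫ z, X z q.1 * u k z ∂mu) * u k q.2) 2 (P.prod mu) := by
    intro k
    obtain ⟨K, hK⟩ := isCompact_univ.exists_bound_of_continuousOn (hu k).continuousOn
    refine ((hcoef k).comp_fst mu).of_le_mul (c := K)
      (((hcoef k).comp_fst mu).aestronglyMeasurable.mul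
        ((hu k).measurable.comp measurable_snd).aestronglyMeasurable) (ae_of_all _ fun q => ?_)
    rw [norm_mul, mul_comm]
    exact mul_le_mul_of_nonneg_right (hK _ (Set.mem_univ _)) (norm_nonneg _)
  have hi : Integrable (fun q : Ω × Z =>
      (X q.2 q.1 - ∑ k, (∫ z, X z q.1 * u k z ∂mu) * u k q.2) ^ 2) (P.prod mu) :=
    (h.sub (memLp_finsetSum _ fun k _ => hcu k)).integrable_sq
  refine ⟨hi, ?_⟩
  rw [integral_prod _ hi]
  have hslice : ∀ᵐ ω ∂P, ∫ z, (X z ω - ∑ k, (∫ z, X z ω * u k z ∂mu) * u k z) ^ 2 ∂mu =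
      ∫ z, X z ω ^ 2 ∂mu - ∑ k, (∫ z, X z ω * u k z ∂mu) ^ 2 := by
    filter_upwards [ae_memLp_two_slice hXm h] with ω hω
    obtain ⟨c, hc⟩ : ∃ c : Fin r → ℝ, ∀ k, ∫ z, X z ω * u k z ∂mu = c k := ⟨_, fun _ => rfl⟩
    simp only [hc]
    have hXu : ∀ k, Integrable (fun z => X z ω * u k z) mu := fun k =>
      hω.integrable_mul (hint (hu k))
    have hXu' : ∀ k, Integrable (fun z => 2 * c k * (X z ω * u k z)) mu := fun k =>
      (hXu k).const_mul _
    have huu : ∀ k l, Integrable (fun z => c k * c l * (u k z * u l z)) mu := fun k l =>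
      ((hint (hu k)).integrable_mul (hint (hu l))).const_mul _
    have e : ∀ z, (X z ω - ∑ k, c k * u k z) ^ 2 =
        X z ω ^ 2 - ∑ k, 2 * c k * (X z ω * u k z) +
          ∑ k, ∑ l, c k * c l * (u k z * u l z) := by
      intro z
      have e1 : ∑ k, 2 * c k * (X z ω * u k z) = 2 * X z ω * ∑ k, c k * u k z := by
        rw [Finset.mul_sum]; exact Finset.sum_congr rfl fun k _ => by ring
      have e2 : ∑ k, ∑ l, c k * c l * (u k z * u l z) = (∑ k, c k * u k z) ^ 2 := by
        rw [sq, Finset.sum_mul_sum]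
        exact Finset.sum_congr rfl fun k _ => Finset.sum_congr rfl fun l _ => by ring
      rw [e1, e2]; ring
    simp only [e]
    have hs1 : Integrable (fun z => ∑ k, 2 * c k * (X z ω * u k z)) mu :=
      integrable_finsetSum _ fun k _ => hXu' k
    have hs2 : Integrable (fun z => ∑ k, ∑ l, c k * c l * (u k z * u l z)) mu :=
      integrable_finsetSum _ fun k _ => integrable_finsetSum _ fun l _ => huu k l
    have hs3 : Integrable (fun z => X z ω ^ 2 - ∑ k, 2 * c k * (X z ω * u k z)) mu :=
      hω.integrable_sq.sub hs1
    rw [integral_add hs3 hs2, integral_sub hω.integrable_sq hs1,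
      integral_finsetSum _ fun k _ => hXu' k,
      integral_finsetSum _ fun k _ => integrable_finsetSum _ fun l _ => huu k l]
    have e3 : ∀ k, ∫ z, ∑ l, c k * c l * (u k z * u l z) ∂mu = c k ^ 2 := fun k => by
      rw [integral_finsetSum _ fun l _ => huu k l]
      simp [integral_const_mul, ho, sq]
    have e4 : ∀ k, ∫ z, 2 * c k * (X z ω * u k z) ∂mu = 2 * c k ^ 2 := fun k => by
      rw [integral_const_mul, hc]; ring
    simp only [e3, e4, ← Finset.mul_sum]
    linarith
  have hsqi : Integrable (fun ω => ∫ z, X z ω ^ 2 ∂mu) P := h.integrable_sq.integral_prod_left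
  rw [integral_congr_ae hslice, integral_sub hsqi
    (integrable_finsetSum _ fun k _ => (hcoef k).integrable_sq),
    integral_finsetSum _ fun k _ => (hcoef k).integrable_sq,
    integral_integral_swap h.integrable_sq]
  simp only [sq]

end KarhunenLoeve

/-- Independence makes the law of `(X, Y)` a product, so the pair avoids null sets of the product
measure. This is what permits substituting a random point into an identity known only for almost
every pair. -/
theorem ae_comp_eq_zero_of_indepFun {Ω Ω' Z : Type*} [MeasurableSpace Ω] [MeasurableSpace Ω']
    [MeasurableSpace Z] {P : Measure Ω} [IsProbabilityMeasure P] {X : Ω → Ω'} {Y : Ω → Z}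
    (hX : Measurable X) (hY : Measurable Y) (hind : IndepFun X Y P) {F : Ω' × Z → ℝ}
    (hF : Measurable F) (h : ∀ᵐ q ∂P.prod (P.map Y), F (X q.1, q.2) = 0) :
    ∀ᵐ ω ∂P, F (X ω, Y ω) = 0 := by
  have hlaw := (indepFun_iff_map_prod_eq_prod_map_map hX.aemeasurable hY.aemeasurable).1 hind
  have hS : MeasurableSet {q : Ω' × Z | F q = 0} := hF (measurableSet_singleton 0)
  have : IsProbabilityMeasure (P.map Y) := Measure.isProbabilityMeasure_map hY.aemeasurable
  have hprod : (P.map X).prod (P.map Y) = (P.prod (P.map Y)).map (Prod.map X id) := by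
    rw [← Measure.map_prod_map _ _ hX measurable_id, Measure.map_id]
  have h1 : ∀ᵐ q ∂(P.map X).prod (P.map Y), F q = 0 := by
    rw [hprod, ae_map_iff (hX.prodMap measurable_id).aemeasurable hS]
    exact h
  rw [← hlaw, ae_map_iff (hX.prodMk hY).aemeasurable hS] at h1
  exact h1

theorem ae_comp_eq_zero_of_indep {Ω Z : Type*} {G mΩ : MeasurableSpace Ω} [mZ : MeasurableSpace Z]
    {P : Measure Ω} [IsProbabilityMeasure P] (hG : G ≤ mΩ) {Y : Ω → Z}
    (hY : Measurable Y) (hind : Indep G (mZ.comap Y) P) {F : Ω × Z → ℝ}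
    (hF : Measurable[G.prod mZ] F) (h : ∀ᵐ q ∂P.prod (P.map Y), F q = 0) :
    ∀ᵐ ω ∂P, F (ω, Y ω) = 0 := by
  -- The identity map into `Ω` equipped with `G` is a random variable generating `G`, so
  -- independence of σ-algebras becomes independence of variables.
  have hid : @Measurable Ω Ω mΩ G id := measurable_id'' hG
  have hindF : @IndepFun Ω Ω Z mΩ G mZ id Y P := by
    refine (@IndepFun_iff_Indep Ω Ω Z mΩ G mZ id Y P).2 ?_
    rw [MeasurableSpace.comap_id]
    exact hind
  exact @ae_comp_eq_zero_of_indepFun Ω Ω Z mΩ G mZ P _ id Y hid hY hindF F hF h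

theorem measurable_residual {Z Ω : Type*} [TopologicalSpace Z] [MeasurableSpace Z] [BorelSpace Z]
    [MeasurableSpace Ω] {mu : Measure Z} [IsProbabilityMeasure mu] {X : Z → Ω → ℝ}
    (hXm : Measurable fun q : Ω × Z => X q.2 q.1) {r : ℕ} {u : Fin r → Z → ℝ}
    (hu : ∀ k, Continuous (u k)) :
    Measurable fun q : Ω × Z => X q.2 q.1 - ∑ k, (∫ z, X z q.1 * u k z ∂mu) * u k q.2 := by
  refine hXm.sub (Finset.measurable_fun_sum _ fun k _ => ?_)
  have h1 : Measurable fun q : Ω × Z => X q.2 q.1 * u k q.2 :=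
    hXm.mul ((hu k).measurable.comp measurable_snd)
  have h2 : Measurable fun ω => ∫ z, X z ω * u k z ∂mu :=
    (h1.stronglyMeasurable.integral_prod_right (ν := mu)).measurable
  exact (h2.comp measurable_fst).mul ((hu k).measurable.comp measurable_snd)

namespace LMM

variable {Z Ω : Type*} [MetricSpace Z] [MeasurableSpace Z] [MeasurableSpace Ω] {p n r : ℕ}
  {M : LMM Z Ω p n} {lam : Fin r → ℝ} {u : Fin r → Z → ℝ}

theorem Valid.sum_integral_mul (hM : M.Valid) (hp : 0 < p) (z z' : Z) :
    ∑ j, ∫ ω, M.psi j z ω * M.psi j z' ω ∂M.P = p * M.kernel z z' := by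
  have hp' : (p : ℝ) ≠ 0 := by exact_mod_cast hp.ne'
  rw [kernel, mul_inv_cancel_left₀ hp', integral_finsetSum]
  exact fun j _ => (hM.psi_sq j z).integrable_mul (hM.psi_sq j z')

theorem Valid.continuous_moment (hM : M.Valid) (j : Fin p) :
    Continuous fun q : Z × Z => ∫ ω, M.psi j q.1 ω * M.psi j q.2 ω ∂M.P :=
  continuous_integral_mul_of_meanSquare (hM.psi_sq j) (hM.psi_cont j)

theorem Valid.continuous_kernel (hM : M.Valid) (hp : 0 < p) :
    Continuous fun q : Z × Z => M.kernel q.1 q.2 := by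
  have h : Continuous fun q : Z × Z => (p : ℝ)⁻¹ * (p * M.kernel q.1 q.2) := by
    simp only [← hM.sum_integral_mul hp]
    exact continuous_const.mul (continuous_finsetSum _ fun j _ => hM.continuous_moment j)
  have hp' : (p : ℝ) ≠ 0 := by exact_mod_cast hp.ne'
  simpa only [inv_mul_cancel_left₀ hp'] using h

theorem Valid.measurable_psi (hM : M.Valid) (j : Fin p) :
    Measurable fun q : Ω × Z => M.psi j q.2 q.1 := by
  obtain ⟨G, hG, hm, -⟩ := hM.indep
  exact (hm j).mono (sup_le_sup (MeasurableSpace.comap_mono (hG j)) le_rfl) le_rfl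

/-- The random functions lie almost surely in the span of the eigenfunctions. -/
theorem Valid.ae_prod_expansion (hM : M.Valid) (hp : 0 < p)
    (h : IsEigensystem M.mu M.kernel lam u) (j : Fin p) :
    ∀ᵐ q ∂M.P.prod M.mu,
      M.psi j q.2 q.1 - ∑ k, (∫ z, M.psi j z q.1 * u k z ∂M.mu) * u k q.2 = 0 := by
  have := hM.prob
  have := hM.compact_space
  have := hM.borel_space
  have := hM.mu_prob
  have := hM.full_support
  have hint : ∀ {g : Z → ℝ}, Continuous g → Integrable g M.mu := fun hg =>
    hg.integrable_of_hasCompactSupport (HasCompactSupport.of_compactSpace _)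
  have hL := fun j => memLp_two_prod_of_continuous (mu := M.mu) (hM.measurable_psi j)
    (hM.psi_sq j) (hM.continuous_moment j)
  have hres := fun j => integral_residual_sq h.continuous h.orthonormal (hM.measurable_psi j) (hL j)
  have hnn : ∀ j, 0 ≤ ∫ q : Ω × Z, (M.psi j q.2 q.1 -
      ∑ k, (∫ z, M.psi j z q.1 * u k z ∂M.mu) * u k q.2) ^ 2 ∂M.P.prod M.mu := fun j =>
    integral_nonneg fun q => sq_nonneg _
  have hmc := fun j => hM.continuous_moment j
  have hmz : ∀ j z, Continuous fun z' => ∫ ω, M.psi j z ω * M.psi j z' ω ∂M.P := fun j z =>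
    (hmc j).comp (Continuous.prodMk_right z)
  have huc := h.continuous
  have hmd : ∀ j, Continuous fun z => ∫ ω, M.psi j z ω * M.psi j z ω ∂M.P := fun j =>
    (hmc j).comp (continuous_id.prodMk continuous_id)
  have hmu : ∀ j k z, Integrable (fun z' =>
      (∫ ω, M.psi j z ω * M.psi j z' ω ∂M.P) * u k z') M.mu := fun j k z =>
    hint ((hmz j z).mul (huc k))
  have hdiag : ∑ j, ∫ z, (∫ ω, M.psi j z ω * M.psi j z ω ∂M.P) ∂M.mu = p * ∑ k, lam k := by
    rw [← integral_finsetSum _ fun j _ => hint (hmd j)]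
    simp only [hM.sum_integral_mul hp, h.kernel_eq (hM.continuous_kernel hp)]
    rw [integral_const_mul, integral_finsetSum _ fun k _ => hint (by fun_prop)]
    simp [integral_const_mul, h.orthonormal]
  have hcoef : ∀ k, ∑ j, ∫ ω, (∫ z, M.psi j z ω * u k z ∂M.mu) ^ 2 ∂M.P = p * lam k := by
    intro k
    have e : ∀ j, ∫ ω, (∫ z, M.psi j z ω * u k z ∂M.mu) ^ 2 ∂M.P = _ := fun j =>
      integral_coefficient_sq (huc k) (hM.measurable_psi j) (hM.psi_sq j) (hL j)
    have hci : ∀ j, Continuous fun z =>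
        (∫ z', (∫ ω, M.psi j z ω * M.psi j z' ω ∂M.P) * u k z' ∂M.mu) * u k z := by
      intro j
      have h1 : Continuous (Function.uncurry fun z z' =>
          (∫ ω, M.psi j z ω * M.psi j z' ω ∂M.P) * u k z') :=
        (hmc j).mul ((huc k).comp continuous_snd)
      have h2 : Continuous fun z =>
          ∫ z', (∫ ω, M.psi j z ω * M.psi j z' ω ∂M.P) * u k z' ∂M.mu := by
        simpa using continuous_parametric_integral_of_continuous (μ := M.mu) h1 isCompact_univ
      exact h2.mul (huc k)
    simp only [e]
    rw [← integral_finsetSum _ fun j _ => hint (hci j)]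
    simp only [← Finset.sum_mul]
    have e2 : ∀ z, ∑ j, ∫ z', (∫ ω, M.psi j z ω * M.psi j z' ω ∂M.P) * u k z' ∂M.mu =
        p * (lam k * u k z) := by
      intro z
      rw [← integral_finsetSum _ fun j _ => hmu j k z, ← h.eigen,
        ← integral_const_mul]
      simp only [← Finset.sum_mul, hM.sum_integral_mul hp, mul_assoc]
    simp only [e2, mul_assoc]
    rw [integral_const_mul, integral_const_mul, h.orthonormal]
    simp
  have hsum : ∑ j, ∫ q : Ω × Z, (M.psi j q.2 q.1 -
      ∑ k, (∫ z, M.psi j z q.1 * u k z ∂M.mu) * u k q.2) ^ 2 ∂M.P.prod M.mu = 0 := by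
    -- The total energy and the energy captured by the eigenfunctions both equal `p ∑ λ_k`; a sum of
    -- nonnegative residuals that vanishes has vanishing terms.
    rw [Finset.sum_congr rfl fun j _ => (hres j).2, Finset.sum_sub_distrib, Finset.sum_comm, hdiag]
    simp only [hcoef, ← Finset.mul_sum, sub_self]
  have hj := (Finset.sum_eq_zero_iff_of_nonneg fun j _ => hnn j).1 hsum j (Finset.mem_univ j)
  filter_upwards [(integral_eq_zero_iff_of_nonneg (fun q => sq_nonneg _) (hres j).1).1 hj] with q hq
  exact pow_eq_zero_iff two_ne_zero |>.1 hq

theorem Valid.ae_psi_eq (hM : M.Valid) (hp : 0 < p) (h : IsEigensystem M.mu M.kernel lam u) :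
    ∀ᵐ ω ∂M.P, ∀ i j,
      M.psi j (M.z i ω) ω = ∑ k, (∫ z, M.psi j z ω * u k z ∂M.mu) * u k (M.z i ω) := by
  have := hM.prob
  have := hM.borel_space
  have := hM.mu_prob
  obtain ⟨G, hG, hm, hind⟩ := hM.indep
  rw [ae_all_iff]
  intro i
  rw [ae_all_iff]
  intro j
  have hij : Indep (G j) (MeasurableSpace.comap (M.z i) ‹MeasurableSpace Z›) M.P :=
    hind.indep (i := Sum.inl j) (j := Sum.inr (Sum.inl i)) (by simp)
  -- Measurability is needed with respect to `G j`, not just the ambient σ-algebra, as only `G j` is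
  -- known to be independent of `z i`.
  have hF := @measurable_residual Z Ω _ _ _ (G j) M.mu _ (M.psi j) (hm j) r u h.continuous
  have hprod := hM.ae_prod_expansion hp h j
  have hij0 := ae_comp_eq_zero_of_indep (hG j) (hM.z_meas i) hij hF (by
    rw [hM.z_law i]; exact hprod)
  filter_upwards [hij0] with ω hω
  exact sub_eq_zero.1 hω

end LMM

/-! ### Spectral quantities and the coefficient β at full rank -/

theorem specNorm_mulVec_le {n : ℕ} (B : Matrix (Fin n) (Fin n) ℝ) (x : Fin n → ℝ) :
    ‖WithLp.toLp 2 (Matrix.mulVec B x)‖ ≤ specNorm B * ‖WithLp.toLp 2 x‖ := by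
  have := (Matrix.toEuclideanCLM (n := Fin n) (𝕜 := ℝ) B).le_opNorm (WithLp.toLp 2 x)
  simpa [specNorm] using this

theorem minEigenvalue_zero {n : ℕ} (hn : 0 < n) :
    minEigenvalue (0 : Matrix (Fin n) (Fin n) ℝ) = 0 := by
  have : Nonempty (Fin n) := ⟨⟨0, hn⟩⟩
  rw [minEigenvalue, spectrum.zero_eq, csInf_singleton]

section BetaCoef

variable {Z : Type*} {r : ℕ} {lam : Fin r → ℝ} {u : Fin r → Z → ℝ}

theorem betaCoef_rank_eq (lam : Fin r → ℝ) (u : Fin r → Z → ℝ) :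
    betaCoef lam u r = ⨆ z, (∑ k, u k z ^ 2) / r := by
  unfold betaCoef
  refine iSup_congr fun z => ?_
  have h1 : (Finset.univ.filter fun l : Fin r => l.val < r) = Finset.univ :=
    Finset.filter_true_of_mem fun l _ => l.isLt
  have h2 : (Finset.univ.filter fun l : Fin r => r ≤ l.val) = ∅ :=
    Finset.filter_false_of_mem fun l _ => not_le.2 l.isLt
  rw [h1, h2]
  simp only [Finset.sum_empty, div_zero, max_self]
  exact max_eq_left (by positivity)

theorem sum_sq_le_betaCoef_mul [TopologicalSpace Z] [CompactSpace Z] (hr : 0 < r)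
    (hu : ∀ k, Continuous (u k)) (z : Z) : ∑ k, u k z ^ 2 ≤ betaCoef lam u r * r := by
  have hr' : (0 : ℝ) < r := by exact_mod_cast hr
  rw [← div_le_iff₀ hr', betaCoef_rank_eq]
  refine le_ciSup (f := fun z => (∑ k, u k z ^ 2) / r) ?_ z
  have hc : Continuous fun z => (∑ k, u k z ^ 2) / r := by fun_prop
  simpa using (isCompact_univ.image hc).bddAbove

/-- A supremum dominates a mean, and `∑ u_k²` has mean `r`. This allows the exponent in `β` from the
Chernoff bound to be weakened to one in `β²`. -/
theorem one_le_betaCoef [TopologicalSpace Z] [CompactSpace Z] [MeasurableSpace Z]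
    [OpensMeasurableSpace Z] {mu : Measure Z} [IsProbabilityMeasure mu] (hr : 0 < r)
    (hu : ∀ k, Continuous (u k))
    (ho : ∀ k l, ∫ z, u k z * u l z ∂mu = if k = l then 1 else 0) : 1 ≤ betaCoef lam u r := by
  have hr' : (0 : ℝ) < r := by exact_mod_cast hr
  have hi : ∀ k, Integrable (fun z => u k z ^ 2) mu := fun k =>
    ((hu k).pow 2).integrable_of_hasCompactSupport (HasCompactSupport.of_compactSpace _)
  have h1 : ∫ z, ∑ k, u k z ^ 2 ∂mu = r := by
    rw [integral_finsetSum _ fun k _ => hi k]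
    simp [sq, ho]
  have h2 : ∫ z, ∑ k, u k z ^ 2 ∂mu ≤ ∫ _z, betaCoef lam u r * r ∂mu :=
    integral_mono (integrable_finsetSum _ fun k _ => hi k) (integrable_const _)
      fun z => sum_sq_le_betaCoef_mul hr hu z
  rw [h1, integral_const, probReal_univ, one_smul] at h2
  nlinarith

end BetaCoef

/-! ### Reduction of the model to the deterministic ridge problem -/

namespace LMM

open Matrix

variable {Z Ω : Type*} [MeasurableSpace Z] [MeasurableSpace Ω] {p n r : ℕ}
  {M : LMM Z Ω p n} {lam : Fin r → ℝ} {u : Fin r → Z → ℝ}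

/-- At `k = r` no feature is left in the tail, so the event `C` reduces to `2 ‖Δ‖ ≥ σ_x² + n γ`. -/
theorem tailGram_rank_eq_zero (M : LMM Z Ω p n) (lam : Fin r → ℝ) (u : Fin r → Z → ℝ) (ω : Ω) :
    M.tailGram lam u r ω = 0 := by
  ext i j
  have h2 : (Finset.univ.filter fun l : Fin r => r ≤ l.val) = ∅ :=
    Finset.filter_false_of_mem fun l _ => not_le.2 l.isLt
  simp [tailGram, h2]

/-- The matrix `(u_k (z_i))` of eigenfunctions evaluated at the latent positions. -/
def eigenMat (M : LMM Z Ω p n) (u : Fin r → Z → ℝ) (ω : Ω) : Matrix (Fin n) (Fin r) ℝ :=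
  Matrix.of fun i k => u k (M.z i ω)

/-- Separates the eigenvalues from a factor with isotropic rows, to which the Chernoff bound
applies. -/
theorem featureMat_eq (M : LMM Z Ω p n) (lam : Fin r → ℝ) (u : Fin r → Z → ℝ) (ω : Ω) :
    M.featureMat lam u ω = M.eigenMat u ω * diagonal fun k => Real.sqrt (lam k) := by
  ext i k
  simp [featureMat, eigenMat, featureMap, mul_diagonal, mul_comm]

theorem featureMat_mul_transpose (M : LMM Z Ω p n) (u : Fin r → Z → ℝ) (ω : Ω)
    (hlam : ∀ k, 0 < lam k) :
    M.featureMat lam u ω * (M.featureMat lam u ω)ᵀ =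
      M.eigenMat u ω * diagonal lam * (M.eigenMat u ω)ᵀ := by
  have h : (diagonal fun k => Real.sqrt (lam k)) * (diagonal fun k => Real.sqrt (lam k)) =
      diagonal lam := by
    rw [diagonal_mul_diagonal]
    simp only [Real.mul_self_sqrt (hlam _).le]
  rw [featureMat_eq, transpose_mul, diagonal_transpose, ← h]
  simp only [Matrix.mul_assoc]

theorem matDelta_isSymm (M : LMM Z Ω p n) (lam : Fin r → ℝ) (u : Fin r → Z → ℝ) (ω : Ω) :
    (M.matDelta lam u ω).IsSymm := by
  unfold matDelta IsSymm
  simp only [transpose_add, transpose_smul, transpose_mul, transpose_sub, transpose_one,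
    transpose_transpose, Matrix.mul_assoc]
  congr 2
  rw [add_comm]

theorem dataMat_eq (hp : 0 < p) (hlam : ∀ k, 0 < lam k) {ω : Ω}
    (hψ : ∀ i j, M.psi j (M.z i ω) ω = ∑ k, (∫ z, M.psi j z ω * u k z ∂M.mu) * u k (M.z i ω)) :
    M.dataMat ω = Real.sqrt p • (M.featureMat lam u ω * (M.weightMat lam u ω)ᵀ) +
      M.sigmaX • M.noiseMat ω := by
  have hp' : (0 : ℝ) < p := by exact_mod_cast hp
  ext i j
  simp only [dataMat, of_apply, Matrix.add_apply, Matrix.smul_apply, smul_eq_mul, noiseMat, mul_apply,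
    transpose_apply, featureMat, weightMat, featureMap, hψ, Finset.mul_sum]
  congr 1
  refine Finset.sum_congr rfl fun k _ => ?_
  rw [Real.sqrt_mul (hlam k).le]
  have h1 := (Real.sqrt_pos.2 (hlam k)).ne'
  have h2 := (Real.sqrt_pos.2 hp').ne'
  field_simp

/-- `Δ` is by design what remains of `p⁻¹ X Xᵀ` after removing `Φ Φᵀ + σ_x² I`. -/
theorem matA_eq (hp : 0 < p) (hlam : ∀ k, 0 < lam k) {ω : Ω}
    (hψ : ∀ i j, M.psi j (M.z i ω) ω = ∑ k, (∫ z, M.psi j z ω * u k z ∂M.mu) * u k (M.z i ω)) :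
    M.matA ω = M.eigenMat u ω * diagonal lam * (M.eigenMat u ω)ᵀ +
      (M.sigmaX ^ 2 + n * M.gamma) • (1 : Matrix (Fin n) (Fin n) ℝ) + M.matDelta lam u ω := by
  have hq : Real.sqrt p ≠ 0 := (Real.sqrt_pos.2 (by exact_mod_cast hp)).ne'
  have hqq : (p : ℝ) = Real.sqrt p * Real.sqrt p := (Real.mul_self_sqrt (Nat.cast_nonneg p)).symm
  rw [← featureMat_mul_transpose M u ω hlam, matA, dataMat_eq hp hlam hψ, matDelta]
  -- With `p = q²` the claim is a rational identity in `q`.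
  generalize Real.sqrt p = q at hq hqq
  rw [hqq]
  simp only [transpose_add, transpose_smul, transpose_mul, transpose_transpose, Matrix.mul_add,
    Matrix.add_mul, Matrix.mul_sub, Matrix.sub_mul, Matrix.mul_smul, Matrix.smul_mul,
    Matrix.mul_one, Matrix.mul_assoc]
  match_scalars <;> field_simp <;> ring

theorem diagNormSq_diagonal_sqrt_mulVec (hlam : ∀ k, 0 < lam k) (x : Fin r → ℝ) :
    diagNormSq lam ((diagonal fun k => Real.sqrt (lam k)) *ᵥ x) =
      ∑ k, (diagonal lam *ᵥ x) k ^ 2 := by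
  refine Finset.sum_congr rfl fun k _ => ?_
  rw [mulVec_diagonal, mulVec_diagonal, mul_pow, Real.sq_sqrt (hlam k).le]
  ring

theorem thetaHat_eq (M : LMM Z Ω p n) (lam : Fin r → ℝ) (u : Fin r → Z → ℝ) (ω : Ω)
    (y : Fin n → ℝ) : M.thetaHat lam u ω y = (diagonal fun k => Real.sqrt (lam k)) *ᵥ
      (((M.eigenMat u ω)ᵀ * (M.matA ω)⁻¹) *ᵥ y) := by
  rw [thetaHat, featureMat_eq, transpose_mul, diagonal_transpose]
  simp only [mulVec_mulVec, Matrix.mul_assoc]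

/-- The substitution `θ = Λ^{1/2} t` absorbs the `Λ`-weighted norm and puts the bias in the form
that `Matrix.ridge_bounds` estimates, with `‖t‖² = ‖θ‖²` in the `Λ⁻¹` norm. -/
theorem bias_eq (hlam : ∀ k, 0 < lam k) (ω : Ω) (theta : Fin r → ℝ) :
    M.bias lam u theta ω =
      ∑ k, ((diagonal lam * (M.eigenMat u ω)ᵀ * (M.matA ω)⁻¹) *ᵥ
        (M.eigenMat u ω *ᵥ (diagonal lam *ᵥ fun k => theta k / Real.sqrt (lam k))) -
        diagonal lam *ᵥ fun k => theta k / Real.sqrt (lam k)) k ^ 2 := by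
  set t : Fin r → ℝ := fun k => theta k / Real.sqrt (lam k) with ht
  have hθ : theta = (diagonal fun k => Real.sqrt (lam k)) *ᵥ t := by
    ext k
    rw [mulVec_diagonal, ht, mul_div_cancel₀ _ (Real.sqrt_pos.2 (hlam k)).ne']
  have hΦ : M.featureMat lam u ω *ᵥ theta = M.eigenMat u ω *ᵥ (diagonal lam *ᵥ t) := by
    rw [featureMat_eq, hθ, mulVec_mulVec, mulVec_mulVec, Matrix.mul_assoc, diagonal_mul_diagonal]
    simp only [Real.mul_self_sqrt (hlam _).le]
  rw [bias, hΦ, thetaHat_eq, hθ, ← mulVec_sub, diagNormSq_diagonal_sqrt_mulVec hlam, mulVec_sub, mulVec_mulVec,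
    ← Matrix.mul_assoc]

theorem diagNormSq_inv_eq (hlam : ∀ k, 0 < lam k) (theta : Fin r → ℝ) :
    ∑ k, (theta k / Real.sqrt (lam k)) ^ 2 = diagNormSq (fun k => (lam k)⁻¹) theta := by
  refine Finset.sum_congr rfl fun k _ => ?_
  rw [div_pow, Real.sq_sqrt (hlam k).le]
  ring

end LMM

/-! ### Variance formula and concentration of the empirical eigenfunctions -/

namespace LMM

open Matrix

variable {Z Ω : Type*} [MetricSpace Z] [MeasurableSpace Z] [MeasurableSpace Ω] {p n r : ℕ}
  {M : LMM Z Ω p n} {lam : Fin r → ℝ} {u : Fin r → Z → ℝ}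

theorem Valid.iIndepFun_z (hM : M.Valid) : iIndepFun M.z M.P := by
  obtain ⟨G, hG, hm, hind⟩ := hM.indep
  exact hind.precomp (g := fun i => Sum.inr (Sum.inl i))
    (Sum.inr_injective.comp Sum.inl_injective)

theorem Valid.integral_eps_mul (hM : M.Valid) (i i' : Fin n) :
    ∫ ω, M.eps i ω * M.eps i' ω ∂M.P = if i = i' then M.sigmaY ^ 2 else 0 := by
  split_ifs with h
  · subst h
    simpa only [sq] using hM.eps_var i
  · obtain ⟨G, hG, hm, hind⟩ := hM.indep
    have hI : IndepFun (M.eps i) (M.eps i') M.P :=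
      hind.indep (i := Sum.inr (Sum.inr (Sum.inr i))) (j := Sum.inr (Sum.inr (Sum.inr i')))
        (by simpa using h)
    rw [hI.integral_fun_mul_eq_mul_integral (hM.eps_meas i).aestronglyMeasurable
      (hM.eps_meas i').aestronglyMeasurable, hM.eps_mean i, zero_mul]

/-- Orthogonality of the response noises leaves only the diagonal terms of the quadratic form. -/
theorem Valid.variance_eq (hM : M.Valid) (hlam : ∀ k, 0 < lam k) (ω : Ω) :
    M.variance lam u ω = M.sigmaY ^ 2 *
      ∑ k, ∑ i, (diagonal lam * (M.eigenMat u ω)ᵀ * (M.matA ω)⁻¹) k i ^ 2 := by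
  set G := diagonal lam * (M.eigenMat u ω)ᵀ * (M.matA ω)⁻¹ with hG
  have e : ∀ ω', diagNormSq lam (M.thetaHat lam u ω fun i => M.eps i ω') =
      ∑ k, ∑ i, ∑ i', G k i * G k i' * (M.eps i ω' * M.eps i' ω') := by
    intro ω'
    rw [thetaHat_eq, diagNormSq_diagonal_sqrt_mulVec hlam, mulVec_mulVec, ← Matrix.mul_assoc, ← hG]
    refine Finset.sum_congr rfl fun k _ => ?_
    rw [mulVec, dotProduct, sq, Finset.sum_mul_sum]
    exact Finset.sum_congr rfl fun i _ => Finset.sum_congr rfl fun i' _ => by ring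
  have hi : ∀ k i i', Integrable (fun ω' => G k i * G k i' * (M.eps i ω' * M.eps i' ω')) M.P :=
    fun k i i' => ((hM.eps_sq i).integrable_mul (hM.eps_sq i')).const_mul _
  rw [LMM.variance, integral_congr_ae (ae_of_all _ e),
    integral_finsetSum _ fun k _ => integrable_finsetSum _ fun i _ =>
      integrable_finsetSum _ fun i' _ => hi k i i', Finset.mul_sum]
  refine Finset.sum_congr rfl fun k _ => ?_
  rw [integral_finsetSum _ fun i _ => integrable_finsetSum _ fun i' _ => hi k i i', Finset.mul_sum]
  refine Finset.sum_congr rfl fun i _ => ?_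
  rw [integral_finsetSum _ fun i' _ => hi k i i']
  simp only [integral_const_mul, hM.integral_eps_mul, mul_ite, mul_zero, Finset.sum_ite_eq,
    Finset.mem_univ, if_true]
  ring

/-- The empirical second moment matrix of the eigenfunctions is bounded below with high
probability. -/
theorem Valid.measureReal_eigenMat_lower_tail_le (hM : M.Valid) (hn : 0 < n) (hr : 0 < r)
    (h : IsEigensystem M.mu M.kernel lam u)
    (hnr : 16 * betaCoef lam u r * r * Real.log r ≤ n) :
    M.P.real {ω | ∃ y : Fin r → ℝ, (M.eigenMat u ω *ᵥ y) ⬝ᵥ (M.eigenMat u ω *ᵥ y) <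
      n / 2 * (y ⬝ᵥ y)} ≤ Real.exp (-(1 / 16 * n / (betaCoef lam u r ^ 2 * r))) := by
  have := hM.prob
  have := hM.compact_space
  have := hM.borel_space
  have := hM.mu_prob
  have : Nonempty (Fin r) := ⟨⟨0, hr⟩⟩
  have hr' : (0 : ℝ) < r := by exact_mod_cast hr
  have hn' : (0 : ℝ) < n := by exact_mod_cast hn
  have hβ := one_le_betaCoef (lam := lam) hr h.continuous h.orthonormal
  have hβr := fun z => sum_sq_le_betaCoef_mul (lam := lam) hr h.continuous z
  set β := betaCoef lam u r with hβdef
  have hβ0 : 0 < β := by linarith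
  have hum : Measurable fun z k => u k z := measurable_pi_iff.2 fun k => (h.continuous k).measurable
  have hch := measureReal_lower_tail_le (P := M.P) (v := fun i ω k => u k (M.z i ω)) (L := β * r)
    (fun i => hum.comp (hM.z_meas i)) (hM.iIndepFun_z.comp (fun _ z k => u k z) fun _ => hum)
    (by positivity) (fun i ω => by simpa [dotProduct, sq] using hβr (M.z i ω))
    (fun i a b => by
      have hm : AEStronglyMeasurable (fun z => u a z * u b z) (M.P.map (M.z i)) :=
        ((h.continuous a).mul (h.continuous b)).measurable.aestronglyMeasurable
      rw [← h.orthonormal a b, ← hM.z_law i, integral_map (hM.z_meas i).aemeasurable hm])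
  have hset : {ω | ∃ y : Fin r → ℝ, (M.eigenMat u ω *ᵥ y) ⬝ᵥ (M.eigenMat u ω *ᵥ y) <
      n / 2 * (y ⬝ᵥ y)} = {ω | ∃ y : Fin r → ℝ,
      ∑ i, ((fun k => u k (M.z i ω)) ⬝ᵥ y) ^ 2 < Fintype.card (Fin n) / 2 * (y ⬝ᵥ y)} := by
    simp only [Fintype.card_fin, dotProduct, mulVec, eigenMat, of_apply, sq]
  rw [hset]
  refine hch.trans ?_
  simp only [Fintype.card_fin]
  -- The dimension factor `r = exp (log r)` is paid for by half of the exponent `n / (8 β r)`, which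
  -- is where the constant 16 in the sample size condition comes from.
  nth_rewrite 1 [← Real.exp_log hr']
  rw [← Real.exp_add, Real.exp_le_exp]
  have h1 : Real.log r ≤ n / (16 * (β * r)) := by
    rw [le_div_iff₀ (by positivity)]; linarith
  have h2 : (1 / 16 * n / (β ^ 2 * r) : ℝ) ≤ n / (16 * (β * r)) := by
    rw [div_le_div_iff₀ (by positivity) (by positivity)]
    have : β * r ≤ β ^ 2 * r := by gcongr; nlinarith
    nlinarith
  have h3 : (n / (8 * (β * r)) : ℝ) = n / (16 * (β * r)) + n / (16 * (β * r)) := by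
    field_simp; ring
  linarith

end LMM

/-! ### Assembly -/

theorem theorem2 :
    ∃ c c' c₁ c₂ : ℝ, 0 < c ∧ 0 < c' ∧ 0 < c₁ ∧ 0 < c₂ ∧
      ∀ (Z Ω : Type*) [MetricSpace Z] [MeasurableSpace Z] [MeasurableSpace Ω]
        (p n r : ℕ), 0 < p → 0 < n → 0 < r →
      ∀ (M : LMM Z Ω p n), M.Valid →
      ∀ (lam : Fin r → ℝ) (u : Fin r → Z → ℝ), IsEigensystem M.mu M.kernel lam u →
      ∀ (g : Z → ℝ) (theta : Fin r → ℝ),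
        (∀ z, g z = ∑ k, featureMap lam u z k * theta k) →
      0 < max M.sigmaX M.gamma →
      c * betaCoef lam u r * r * Real.log r ≤ n →
      1 - 16 * Real.exp (-(c' * n / (betaCoef lam u r ^ 2 * r)))
          - 2 * M.P.real (M.eventC lam u r) ≤
        M.P.real {ω | IsUnit (M.matA ω).det ∧
          M.variance lam u ω ≤ c₁ * M.sigmaY ^ 2 * (r / n) ∧
          M.bias lam u theta ω ≤
            c₂ * (diagNormSq (fun k => (lam k)⁻¹) theta / n ^ 2 *
              (M.sigmaX ^ 2 + n * M.gamma) ^ 2)} := by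
  refine ⟨16, 1 / 16, 32, 144, by norm_num, by norm_num, by norm_num, by norm_num, ?_⟩
  intro Z Ω _ _ _ p n r hp hn hr M hM lam u h g theta _ hmax hnr
  have := hM.prob
  have hn' : (0 : ℝ) < n := by exact_mod_cast hn
  set good : Set Ω := {ω | IsUnit (M.matA ω).det ∧
    M.variance lam u ω ≤ 32 * M.sigmaY ^ 2 * (r / n) ∧
    M.bias lam u theta ω ≤ 144 * (diagNormSq (fun k => (lam k)⁻¹) theta / n ^ 2 *
      (M.sigmaX ^ 2 + n * M.gamma) ^ 2)} with hgood
  set bad : Set Ω := {ω | ∃ y : Fin r → ℝ,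
    dotProduct (Matrix.mulVec (M.eigenMat u ω) y) (Matrix.mulVec (M.eigenMat u ω) y) <
      n / 2 * (dotProduct y y)} with hbad
  set null : Set Ω := {ω | ¬ ∀ i j, M.psi j (M.z i ω) ω =
    ∑ k, (∫ z, M.psi j z ω * u k z ∂M.mu) * u k (M.z i ω)} with hnull
  have hs : 0 < M.sigmaX ^ 2 + n * M.gamma := by
    rcases lt_max_iff.1 hmax with h1 | h1
    · have := mul_nonneg hn'.le hM.gamma_nonneg; positivity
    · have := mul_pos hn' h1; positivity
  -- Only subadditivity of the measure is applied to this cover, so measurability of the four sets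
  -- plays no role.
  have hcover : Set.univ ⊆ good ∪ (bad ∪ (M.eventC lam u r ∪ null)) := by
    intro ω _
    by_contra hω
    simp only [Set.mem_union, not_or] at hω
    obtain ⟨hng, hnb, hnC, hnn⟩ := hω
    have hψ := not_not.1 hnn
    have hU : ∀ y : Fin r → ℝ, (n : ℝ) / 2 * (dotProduct y y) ≤
        dotProduct (Matrix.mulVec (M.eigenMat u ω) y) (Matrix.mulVec (M.eigenMat u ω) y) :=
      fun y => not_lt.1 fun hy => hnb ⟨y, hy⟩
    have hC : 2 * specNorm (M.matDelta lam u ω) < M.sigmaX ^ 2 + n * M.gamma := by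
      have := not_le.1 (show ¬ (minEigenvalue (M.tailGram lam u r ω) + M.sigmaX ^ 2 + n * M.gamma ≤
        2 * specNorm (M.matDelta lam u ω)) from hnC)
      rwa [M.tailGram_rank_eq_zero, minEigenvalue_zero hn, zero_add] at this
    have hD : ∀ x, ‖WithLp.toLp 2 (Matrix.mulVec (M.matDelta lam u ω) x)‖ ≤
        (M.sigmaX ^ 2 + n * M.gamma) / 2 * ‖WithLp.toLp 2 x‖ := fun x =>
      (specNorm_mulVec_le _ x).trans (mul_le_mul_of_nonneg_right (by linarith) (norm_nonneg _))
    obtain ⟨hdet, hvar, hbias⟩ := Matrix.ridge_bounds h.pos (M.matDelta_isSymm lam u ω) hs hn' hD hU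
      (LMM.matA_eq hp h.pos hψ)
    refine hng ⟨hdet, ?_, ?_⟩
    · rw [hM.variance_eq h.pos]
      rw [Fintype.card_fin] at hvar
      calc _ ≤ M.sigmaY ^ 2 * (32 * (r / n)) := mul_le_mul_of_nonneg_left hvar (sq_nonneg _)
        _ = _ := by ring
    · rw [LMM.bias_eq h.pos]
      refine (hbias _).trans_eq ?_
      rw [LMM.diagNormSq_inv_eq h.pos]
      ring
  have hnull0 : M.P.real null = 0 := by
    rw [measureReal_eq_zero_iff]
    exact hM.ae_psi_eq hp h
  have hbad1 := hM.measureReal_eigenMat_lower_tail_le hn hr h hnr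
  have h1 : 1 ≤ M.P.real good + (M.P.real bad + (M.P.real (M.eventC lam u r) + M.P.real null)) := by
    calc (1 : ℝ) = M.P.real Set.univ := probReal_univ.symm
      _ ≤ M.P.real (good ∪ (bad ∪ (M.eventC lam u r ∪ null))) := measureReal_mono hcover
      _ ≤ _ := (measureReal_union_le _ _).trans (by
        gcongr
        refine (measureReal_union_le _ _).trans ?_
        gcongr
        exact measureReal_union_le _ _)
  -- The union bound loses one exponential and one copy of the probability of `C`; nonnegativity of
  -- both terms gives the weaker factors 16 and 2.
  have h2 : 0 ≤ M.P.real (M.eventC lam u r) := measureReal_nonneg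
  have h3 := Real.exp_pos (-(1 / 16 * n / (betaCoef lam u r ^ 2 * r)))
  linarith
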